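/- **Theorem (nomadic online TSP on the line).** A server starts at time $0$ at the origin $o=0$ of the real line and moves with at most unit speed. An input is a finite set $\sigma$ of requests $r=(t_r,e_r)$ with release time $t_r\ge 0$ and location $e_r\in\mathbb R$; $r$ becomes known at time $t_r$ and is served at the first time $t\ge t_r$ at which the server is at $e_r$. The cost is the largest completion time (no return to $o$). $OPT(\sigma)$ is the optimal offline cost. A deterministic online algorithm $A$ determines the server's position $pos_A(\sigma,t)$ at time $t$ from the requests released up to time $t$ only; $A(\sigma)$ is its cost, and $A$ is $c$-competitive on a class of inputs if $A(\sigma)\le c\cdot OPT(\sigma)$ for all $\sigma$ in the class. For an input $\sigma$ let $L'\le R'$ be the extreme points of $\{e_r : r\in\sigma\}\cup\{o\}$, $\mathbb L=|o-L'|$, $\mathbb R=|o-R'|$, $D=\mathbb L+\mathbb R$ (the length of the interval spanned by the input and the origin), $\beta=\min\{\mathbb L,\mathbb R\}/D$, and $t_{\max}$ the last release time. An input has spatial locality $\Delta$ for $A$ if $|pos_A(\sigma,t_r)-e_r|\le\Delta$ for every $r\in\sigma$. *The sweep.* The server waits at $o$ until the first request. At each release time, let $x$ be its position and $L\le R$ the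 extreme locations of the outstanding requests, including the new ones. If both lie on the same side of $x$ (or at $x$), it plans to move to the one farther from $x$; otherwise it plans to move first to the nearer one of $L,R$ (to $L$ in a tie) and then to the other. It follows this plan at unit speed until the next release time; when the plan is completed, it waits. *The algorithm $\mathrm{ALG}_B(\delta,\beta)$*, which knows $\delta$ and $\beta$ in advance and uses an online algorithm $B$ for the original model (arbitrary inputs, no locality) as a subroutine: if $1+\frac{1+\delta}{1+\beta}\ge 2.04$, run $B$; otherwise run the sweep. Then there exists a deterministic online algorithm $B$ that is $2.04$-competitive on all inputs (as proved by Bjelde et al.). For every such $B$ and all real $D>0$, $0\le\delta\le1$, $0\le\beta\le\frac12$, the algorithm $\mathrm{ALG}_B(\delta,\beta)$ is $$\min\Big\{2.04,\ 1+\frac{1+\delta}{1+\beta}\Big\}\text{-competitive}$$ on all inputs with parameters $D$ and $\beta$ that have spatial locality $\Delta=\delta D$ for it. Moreover, every such input satisfies $OPT(\sigma)\ge\max\{t_{\max},(1+\beta)D\}$, and if $1+\frac{1+\delta}{1+\beta}<2.04$ (the sweep is run), then the cost of the algorithm is at most $t_{\max}+\Delta+D$. -/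

import Mathlib

open scoped NNReal ENNReal

namespace LineTSP

/-- A request: it is released at time `time` and asks for a visit of the point `loc` of the line.
Coordinates on the line are chosen such that the origin is `0`. -/
structure Request where
  time : ℝ≥0
  loc : ℝ

/-- A route of a single server: it starts at the origin and moves with at most unit speed. -/
structure IsRoute (p : ℝ≥0 → ℝ) : Prop where
  start : p 0 = 0
  speed : LipschitzWith 1 p

/-- Request `r` is served at time `t` on the route `p`. -/
def ServedAt (p : ℝ≥0 → ℝ) (r : Request) (t : ℝ≥0) : Prop :=
  r.time ≤ t ∧ p t = r.loc

/-- Completion time of a request: the first time at which it is served (`⊤` if it never is). -/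
noncomputable def completionTime (p : ℝ≥0 → ℝ) (r : Request) : ℝ≥0∞ :=
  ⨅ (t : ℝ≥0) (_ : ServedAt p r t), (t : ℝ≥0∞)

/-- Maximum completion time over all requests (the server need not return to the origin). -/
noncomputable def makespan (p : ℝ≥0 → ℝ) (σ : Finset Request) : ℝ≥0∞ :=
  ⨆ r ∈ σ, completionTime p r

/-- Optimal offline cost. -/
noncomputable def OPT (σ : Finset Request) : ℝ≥0∞ :=
  ⨅ (p : ℝ≥0 → ℝ) (_ : IsRoute p), makespan p σ

/-- The requests revealed up to time `t`. -/
noncomputable def revealed (σ : Finset Request) (t : ℝ≥0) : Finset Request :=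
  σ.filter (fun r => r.time ≤ t)

/-- A deterministic online algorithm for a single server: every input is mapped to a route, and
the position at time `t` depends only on the requests revealed up to time `t`. -/
structure OnlineAlgorithm where
  pos : Finset Request → ℝ≥0 → ℝ
  isRoute : ∀ σ, IsRoute (pos σ)
  causal : ∀ σ σ' t, revealed σ t = revealed σ' t → pos σ t = pos σ' t

/-- The cost `OL(σ)` of an online algorithm. -/
noncomputable def OnlineAlgorithm.cost (A : OnlineAlgorithm) (σ : Finset Request) : ℝ≥0∞ :=
  makespan (A.pos σ) σ

/-- `A` is `c`-competitive on the inputs in `I`. -/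
def OnlineAlgorithm.IsCompetitiveOn (A : OnlineAlgorithm) (I : Set (Finset Request)) (c : ℝ) :
    Prop :=
  ∀ σ ∈ I, A.cost σ ≤ ENNReal.ofReal c * OPT σ

/-- `A` is `c`-competitive in the original model, i.e. on all inputs. -/
def OnlineAlgorithm.IsCompetitive (A : OnlineAlgorithm) (c : ℝ) : Prop :=
  A.IsCompetitiveOn Set.univ c

/-- Spatial locality: a request arriving at time `t` lies within distance `Δ` of the current
position of the server of `A`. -/
def SpatiallyLocal (A : OnlineAlgorithm) (Δ : ℝ) (σ : Finset Request) : Prop :=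
  ∀ r ∈ σ, |A.pos σ r.time - r.loc| ≤ Δ

/-- The locations of the requests together with the origin. -/
noncomputable def points (σ : Finset Request) : Finset ℝ :=
  insert 0 (σ.image Request.loc)

theorem points_nonempty (σ : Finset Request) : (points σ).Nonempty :=
  Finset.insert_nonempty _ _

/-- Distance from the origin to the leftmost point of the input. -/
noncomputable def leftLength (σ : Finset Request) : ℝ :=
  |0 - (points σ).min' (points_nonempty σ)|

/-- Distance from the origin to the rightmost point of the input. -/
noncomputable def rightLength (σ : Finset Request) : ℝ :=
  |0 - (points σ).max' (points_nonempty σ)|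

/-- The last release time. -/
noncomputable def lastRelease (σ : Finset Request) : ℝ≥0 :=
  σ.sup Request.time

/-- Position after travelling for `s` time units at unit speed from `x` towards `a`, stopping
at `a`. -/
noncomputable def moveToward (x a s : ℝ) : ℝ :=
  x + max (-s) (min s (a - x))

/-- Position after `s` time units on the tour from `x` to `a` and then to `b`, at unit speed,
stopping at `b`. -/
noncomputable def walk (x a b s : ℝ) : ℝ :=
  if s ≤ |a - x| then moveToward x a s else moveToward a b (s - |a - x|)

/-- The tour of the server at position `x` when `l` and `r` are the leftmost and the rightmost
outstanding location: the pair of the first and the second turning point. -/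
noncomputable def chooseTour (x l r : ℝ) : ℝ × ℝ :=
  if r ≤ x then (l, l)
  else if x ≤ l then (r, r)
  else if x - l ≤ r - x then (l, r)
  else (r, l)

open Classical in
/-- The locations of the requests outstanding at time `τ` on the route `p`. -/
noncomputable def outstanding (σ : Finset Request) (p : ℝ≥0 → ℝ) (τ : ℝ≥0) : Finset ℝ :=
  ((revealed σ τ).filter (fun r => ¬ ∃ u ≤ τ, ServedAt p r u)).image Request.loc

/-- The tour computed at position `x` for a set `S` of outstanding locations. -/
noncomputable def tour (x : ℝ) (S : Finset ℝ) : ℝ × ℝ :=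
  if h : S.Nonempty then chooseTour x (S.min' h) (S.max' h) else (x, x)

/-- Recomputation at time `τ`: the route `p` is kept up to time `τ`, and from then on the server
traverses the tour computed for the requests outstanding at time `τ`. -/
noncomputable def replan (σ : Finset Request) (p : ℝ≥0 → ℝ) (τ : ℝ≥0) : ℝ≥0 → ℝ := fun t =>
  if t ≤ τ then p t
  else walk (p τ) (tour (p τ) (outstanding σ p τ)).1 (tour (p τ) (outstanding σ p τ)).2
    ((t : ℝ) - (τ : ℝ))

/-- The release times in increasing order. -/
noncomputable def releaseTimes (σ : Finset Request) : List ℝ≥0 :=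
  (σ.image Request.time).sort (· ≤ ·)

/-- The route of the sweep strategy: wait at the origin, and recompute the tour at each release
time, in increasing order. -/
noncomputable def sweepPos (σ : Finset Request) : ℝ≥0 → ℝ :=
  (releaseTimes σ).foldl (replan σ) (fun _ => 0)

/-! The sweep strategy is an online algorithm. -/

theorem moveToward_zero (x a : ℝ) : moveToward x a 0 = x := by
  unfold moveToward
  rcases le_total 0 (a - x) with h | h <;> simp [h]

theorem moveToward_abs (x a : ℝ) : moveToward x a |a - x| = a := by
  unfold moveToward
  rw [min_eq_right (le_abs_self _), max_eq_right (neg_abs_le _)]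
  ring

theorem moveToward_lip (x a s t : ℝ) : |moveToward x a s - moveToward x a t| ≤ |s - t| := by
  unfold moveToward
  rw [add_sub_add_left_eq_sub]
  refine (abs_max_sub_max_le_max _ _ _ _).trans (max_le ?_ ?_)
  · rw [neg_sub_neg, abs_sub_comm]
  · refine (abs_min_sub_min_le_max _ _ _ _).trans (max_le le_rfl ?_)
    simp

theorem walk_zero (x a b : ℝ) : walk x a b 0 = x := by
  simp [walk, moveToward_zero]

theorem walk_lip_le (x a b : ℝ) {s t : ℝ} (h : s ≤ t) :
    |walk x a b s - walk x a b t| ≤ t - s := by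
  have key : ∀ y c u v : ℝ, u ≤ v → |moveToward y c u - moveToward y c v| ≤ v - u := by
    intro y c u v huv
    refine (moveToward_lip y c u v).trans (le_of_eq ?_)
    rw [abs_sub_comm, abs_of_nonneg (by linarith)]
  unfold walk
  split_ifs with h1 h2 h2
  · exact key _ _ _ _ h
  · push Not at h2
    have e1 := key x a s |a - x| h1
    have e2 := key a b 0 (t - |a - x|) (by linarith)
    rw [moveToward_abs] at e1
    rw [moveToward_zero] at e2
    have := abs_sub_le (moveToward x a s) a (moveToward a b (t - |a - x|))
    linarith
  · linarith
  · have := key a b (s - |a - x|) (t - |a - x|) (by linarith)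
    linarith

theorem replan_isRoute (σ : Finset Request) (p : ℝ≥0 → ℝ) (τ : ℝ≥0) (hp : IsRoute p) :
    IsRoute (replan σ p τ) := by
  refine ⟨by simp [replan, hp.start], ?_⟩
  have hlip : ∀ s t : ℝ≥0, s ≤ t → |p s - p t| ≤ (t : ℝ) - s := by
    intro s t h
    have h1 := hp.speed.dist_le_mul s t
    have h2 : (s : ℝ) ≤ t := by exact_mod_cast h
    rw [Real.dist_eq, NNReal.dist_eq, abs_sub_comm (s : ℝ),
      abs_of_nonneg (by linarith : (0 : ℝ) ≤ t - s), NNReal.coe_one, one_mul] at h1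
    exact h1
  have main : ∀ s t : ℝ≥0, s ≤ t →
      |replan σ p τ s - replan σ p τ t| ≤ (t : ℝ) - s := by
    intro s t h
    have h' : (s : ℝ) ≤ t := by exact_mod_cast h
    unfold replan
    generalize tour (p τ) (outstanding σ p τ) = ab
    split_ifs with h1 h2 h2
    · exact hlip s t h
    · push Not at h2
      have e1 := hlip s τ h1
      have h3 : (τ : ℝ) ≤ t := by exact_mod_cast h2.le
      have e2 := walk_lip_le (p τ) ab.1 ab.2 (s := 0) (t := (t : ℝ) - τ) (by linarith)
      rw [walk_zero] at e2
      have := abs_sub_le (p s) (p τ) (walk (p τ) ab.1 ab.2 ((t : ℝ) - τ))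
      linarith
    · exact absurd (h.trans h2) h1
    · have := walk_lip_le (p τ) ab.1 ab.2 (s := (s : ℝ) - τ) (t := (t : ℝ) - τ) (by linarith)
      linarith
  refine LipschitzWith.of_dist_le_mul fun s t => ?_
  rw [Real.dist_eq, NNReal.dist_eq, NNReal.coe_one, one_mul]
  rcases le_total s t with h | h
  · have h' : (s : ℝ) ≤ t := by exact_mod_cast h
    rw [abs_sub_comm (s : ℝ), abs_of_nonneg (by linarith : (0 : ℝ) ≤ t - s)]
    exact main s t h
  · have h' : (t : ℝ) ≤ s := by exact_mod_cast h
    rw [abs_sub_comm (replan σ p τ s), abs_of_nonneg (by linarith : (0 : ℝ) ≤ s - t)]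
    exact main t s h

theorem foldl_replan_isRoute (σ : Finset Request) (l : List ℝ≥0) (p : ℝ≥0 → ℝ) (hp : IsRoute p) :
    IsRoute (l.foldl (replan σ) p) := by
  induction l generalizing p with
  | nil => exact hp
  | cons τ l ih => exact ih _ (replan_isRoute σ p τ hp)

theorem foldl_replan_of_le (σ : Finset Request) (t : ℝ≥0) (l : List ℝ≥0) (p : ℝ≥0 → ℝ)
    (h : ∀ τ ∈ l, t ≤ τ) : l.foldl (replan σ) p t = p t := by
  induction l generalizing p with
  | nil => rfl
  | cons τ l ih =>
    rw [List.foldl_cons, ih _ fun u hu => h u (List.mem_cons_of_mem _ hu)]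
    simp [replan, h τ List.mem_cons_self]

theorem foldl_replan_filter (σ : Finset Request) (t : ℝ≥0) (l : List ℝ≥0) (p : ℝ≥0 → ℝ)
    (hl : l.Pairwise (· < ·)) :
    l.foldl (replan σ) p t = (l.filter (fun τ => decide (τ ≤ t))).foldl (replan σ) p t := by
  induction l generalizing p with
  | nil => rfl
  | cons τ l ih =>
    rw [List.pairwise_cons] at hl
    by_cases h : τ ≤ t
    · simp only [List.foldl_cons, List.filter_cons, h, decide_true, if_true]
      exact ih _ hl.2
    · push Not at h
      rw [foldl_replan_of_le σ t (τ :: l) p, foldl_replan_of_le]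
      · intro u hu
        have := hl.1
        simp only [List.mem_filter, List.mem_cons, decide_eq_true_eq] at hu
        rcases hu.1 with rfl | h2
        · exact h.le
        · exact h.le.trans (this u h2).le
      · intro u hu
        rcases List.mem_cons.1 hu with rfl | h2
        · exact h.le
        · exact h.le.trans (hl.1 u h2).le

theorem revealed_mono {σ σ' : Finset Request} {t τ : ℝ≥0} (h : revealed σ t = revealed σ' t)
    (hτ : τ ≤ t) : revealed σ τ = revealed σ' τ := by
  ext r
  have := congrArg (fun s => r ∈ s) h
  simp only [revealed, Finset.mem_filter, eq_iff_iff] at this ⊢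
  constructor
  · rintro ⟨h1, h2⟩
    exact ⟨(this.1 ⟨h1, h2.trans hτ⟩).1, h2⟩
  · rintro ⟨h1, h2⟩
    exact ⟨(this.2 ⟨h1, h2.trans hτ⟩).1, h2⟩

theorem foldl_replan_congr {σ σ' : Finset Request} {t : ℝ≥0} (h : revealed σ t = revealed σ' t)
    (l : List ℝ≥0) (p : ℝ≥0 → ℝ) (hl : ∀ τ ∈ l, τ ≤ t) :
    l.foldl (replan σ) p = l.foldl (replan σ') p := by
  induction l generalizing p with
  | nil => rfl
  | cons τ l ih =>
    have e : replan σ p τ = replan σ' p τ := by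
      unfold replan outstanding
      rw [revealed_mono h (hl τ List.mem_cons_self)]
    rw [List.foldl_cons, List.foldl_cons, e]
    exact ih _ fun u hu => hl u (List.mem_cons_of_mem _ hu)

theorem releaseTimes_filter {σ σ' : Finset Request} {t : ℝ≥0}
    (h : revealed σ t = revealed σ' t) :
    (releaseTimes σ).filter (fun τ => decide (τ ≤ t)) =
      (releaseTimes σ').filter (fun τ => decide (τ ≤ t)) := by
  have hs : ∀ ρ : Finset Request,
      ((releaseTimes ρ).filter (fun τ => decide (τ ≤ t))).Pairwise (· < ·) := fun ρ =>
    List.Pairwise.filter _ (Finset.sortedLT_sort _).pairwise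
  refine List.Perm.eq_of_pairwise' (hs σ) (hs σ') ?_
  rw [List.perm_ext_iff_of_nodup ((hs σ).imp fun h => h.ne) ((hs σ').imp fun h => h.ne)]
  have key : ∀ {ρ ρ' : Finset Request}, revealed ρ t = revealed ρ' t → ∀ u,
      u ∈ (releaseTimes ρ).filter (fun τ => decide (τ ≤ t)) →
      u ∈ (releaseTimes ρ').filter (fun τ => decide (τ ≤ t)) := by
    intro ρ ρ' hρ u hu
    simp only [releaseTimes, List.mem_filter, Finset.mem_sort, Finset.mem_image,
      decide_eq_true_eq] at hu ⊢
    obtain ⟨⟨r, hr, rfl⟩, hu⟩ := hu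
    have : r ∈ revealed ρ' t := hρ ▸ Finset.mem_filter.2 ⟨hr, hu⟩
    exact ⟨⟨r, (Finset.mem_filter.1 this).1, rfl⟩, hu⟩
  exact fun u => ⟨key h u, key h.symm u⟩

/-- The sweep strategy. -/
noncomputable def sweep : OnlineAlgorithm where
  pos := sweepPos
  isRoute σ := foldl_replan_isRoute σ _ _ ⟨rfl, LipschitzWith.const' 0⟩
  causal σ σ' t h := by
    have hs : ∀ ρ : Finset Request, (releaseTimes ρ).Pairwise (· < ·) := fun ρ =>
      (Finset.sortedLT_sort _).pairwise
    unfold sweepPos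
    rw [foldl_replan_filter σ t _ _ (hs σ),
      foldl_replan_filter σ' t _ _ (hs σ'), releaseTimes_filter h]
    refine congrFun (foldl_replan_congr h _ _ fun τ hτ => ?_) t
    simpa using (List.mem_filter.1 hτ).2

open Classical in
/-- The algorithm for the line with known parameters `δ` and `β`, with a given algorithm `B` for
the original model as a subroutine. -/
noncomputable def lineAlgorithm (B : OnlineAlgorithm) (δ β : ℝ) : OnlineAlgorithm :=
  if 1 + (1 + δ) / (1 + β) ≥ 2.04 then B else sweep

/-- The inputs on an interval of length `D` in which the shorter of the two sides, as seen from
the origin, has length `β * D`, and which arrive with spatial locality `Δ` for `A`. The interval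
is the one spanned by the requests and the origin. -/
def lineInputs (A : OnlineAlgorithm) (D β Δ : ℝ) : Set (Finset Request) :=
  {σ | leftLength σ + rightLength σ = D ∧ min (leftLength σ) (rightLength σ) / D = β ∧
    SpatiallyLocal A Δ σ}

end LineTSP

namespace LineTSP

/-! ### Routes, feasible makespans and the optimal cost -/

/-! The sweep: new requests appear within Δ of the server, so on one of its two sides all
outstanding requests always stay within Δ (`SweepInvariant`). A tour that visits the nearer end
first therefore spends at most Δ before its turn and at most D afterwards, so the cost is at most
t_max + Δ + D (`sweep_cost_le`). Every offline route needs t_max, and it needs (1 + β)D because it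
reaches one extreme point and then crosses the whole span (`FeasibleBy.length_le`). Dividing gives
the ratio 1 + (1 + δ)/(1 + β).

The 2.04-competitive algorithm: requests may be postponed until |loc| ≤ time, as no route serves
them earlier. The online server follows a zigzag through the pending interval [A, B] that is on time
if nothing else arrives (`Good`). A new request inside [A, B] needs no change. One outside, say r to
the right of B, needs a new zigzag, and `State` records what makes one possible. The server stays in
the cone |p| ≤ 0.6 t, so t + p ≤ 1.6 · time at each release. A pending left end l can still be
reached by its deadline 2.04 · l.time + 1.04 (X - A), after which a final crossing to r is within
2.04 times the optimum (`FeasibleBy.switch_bound`). Finally, the server is near l, or has approached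
it since its release. In the near case l is served first and r last (`exists_good_new_last`).
Otherwise l was released so recently that r can be served first and l last
(`exists_good_new_first`). -/

theorem IsRoute.abs_sub_le {p : ℝ≥0 → ℝ} (hp : IsRoute p) (s t : ℝ≥0) :
    |p s - p t| ≤ |(s : ℝ) - t| := by
  have h := hp.speed.dist_le_mul s t
  rwa [Real.dist_eq, NNReal.dist_eq, NNReal.coe_one, one_mul] at h

theorem IsRoute.of_le {p : ℝ≥0 → ℝ} (h0 : p 0 = 0)
    (h : ∀ s t : ℝ≥0, s ≤ t → |p s - p t| ≤ (t : ℝ) - s) : IsRoute p := by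
  refine ⟨h0, LipschitzWith.of_dist_le_mul fun s t => ?_⟩
  rw [Real.dist_eq, NNReal.dist_eq, NNReal.coe_one, one_mul]
  rcases le_total s t with hst | hst
  · rw [abs_sub_comm (s : ℝ)]
    exact (h s t hst).trans (le_abs_self _)
  · rw [abs_sub_comm (p s)]
    exact (h t s hst).trans (le_abs_self _)

/-- A route attains all intermediate values. -/
theorem IsRoute.exists_eq {p : ℝ≥0 → ℝ} (hp : IsRoute p) {s t : ℝ≥0} (hst : s ≤ t) {x : ℝ}
    (h : x ∈ Set.uIcc (p s) (p t)) : ∃ u, s ≤ u ∧ u ≤ t ∧ p u = x := by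
  obtain ⟨u, hu, rfl⟩ := intermediate_value_uIcc (hp.speed.continuous.continuousOn) h
  rw [Set.uIcc_of_le hst] at hu
  exact ⟨u, hu.1, hu.2, rfl⟩

/-- Some route serves all requests of `σ` by time `M`. -/
def FeasibleBy (σ : Finset Request) (M : ℝ) : Prop :=
  0 ≤ M ∧ ∃ p, IsRoute p ∧ ∀ r ∈ σ, ∃ u : ℝ≥0, ServedAt p r u ∧ (u : ℝ) ≤ M

theorem FeasibleBy.mono {σ σ' : Finset Request} {M : ℝ} (h : FeasibleBy σ' M) (hσ : σ ⊆ σ') :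
    FeasibleBy σ M := by
  obtain ⟨h0, p, hp, h⟩ := h
  exact ⟨h0, p, hp, fun r hr => h r (hσ hr)⟩

/-- This avoids asking whether the infima in `OPT` and `completionTime` are attained. If the bound
failed, some route would have makespan below x / k; a value m strictly between leaves room to
replace every completion time by an actual time of service. -/
theorem ofReal_le_mul_OPT {σ : Finset Request} {x k : ℝ} (hk : 0 < k)
    (h : ∀ M, FeasibleBy σ M → x ≤ k * M) : ENNReal.ofReal x ≤ ENNReal.ofReal k * OPT σ := by
  by_contra! hlt
  have hk' : ENNReal.ofReal k ≠ 0 := by simpa using hk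
  have h1 : OPT σ < ENNReal.ofReal x / ENNReal.ofReal k := by
    rw [ENNReal.lt_div_iff_mul_lt (Or.inl hk') (Or.inl ENNReal.ofReal_ne_top), mul_comm]
    exact hlt
  rw [← ENNReal.ofReal_div_of_pos hk] at h1
  simp only [OPT, iInf_lt_iff] at h1
  obtain ⟨p, hp, h1⟩ := h1
  obtain ⟨m, hm1, hm2⟩ := exists_between h1
  have hmt : m ≠ ⊤ := (hm2.trans ENNReal.ofReal_lt_top).ne
  have hf : FeasibleBy σ m.toReal := by
    refine ⟨ENNReal.toReal_nonneg, p, hp, fun r hr => ?_⟩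
    have h2 : completionTime p r < m := lt_of_le_of_lt (le_iSup₂_of_le r hr le_rfl) hm1
    simp only [completionTime, iInf_lt_iff] at h2
    obtain ⟨u, hu, hum⟩ := h2
    refine ⟨u, hu, ?_⟩
    have := (ENNReal.toReal_le_toReal ENNReal.coe_ne_top hmt).2 hum.le
    simpa using this
  have h3 := h _ hf
  have h4 : m.toReal < x / k := by
    rw [← ENNReal.ofReal_toReal hmt] at hm2
    exact (ENNReal.ofReal_lt_ofReal_iff_of_nonneg ENNReal.toReal_nonneg).1 hm2
  rw [lt_div_iff₀ hk] at h4
  linarith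

theorem makespan_le_ofReal {σ : Finset Request} {p : ℝ≥0 → ℝ} {T : ℝ}
    (h : ∀ r ∈ σ, ∃ u : ℝ≥0, ServedAt p r u ∧ (u : ℝ) ≤ T) :
    makespan p σ ≤ ENNReal.ofReal T := by
  refine iSup₂_le fun r hr => ?_
  obtain ⟨u, hu, huT⟩ := h r hr
  refine iInf₂_le_of_le u hu ?_
  rw [← ENNReal.ofReal_coe_nnreal]
  exact ENNReal.ofReal_le_ofReal huT

/-! ### Affine legs -/

/-- The route `q` up to time `t₀`, followed by an affine move which reaches `x` at time `t₁`. -/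
noncomputable def leg (q : ℝ≥0 → ℝ) (t₀ t₁ : ℝ≥0) (x : ℝ) : ℝ≥0 → ℝ := fun t =>
  q (min t t₀) + (x - q t₀) / (t₁ - t₀) * (min (max (t : ℝ) t₀) t₁ - t₀)

section Leg

variable {q : ℝ≥0 → ℝ} {t₀ t₁ : ℝ≥0} {x : ℝ}

theorem leg_of_le (h : t₀ ≤ t₁) {t : ℝ≥0} (ht : t ≤ t₀) : leg q t₀ t₁ x t = q t := by
  have h' : (t₀ : ℝ) ≤ t₁ := h
  have ht' : (t : ℝ) ≤ t₀ := ht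
  simp [leg, min_eq_left ht, max_eq_right ht', min_eq_left h']

theorem leg_of_ge (h : t₀ ≤ t₁) (hx : |x - q t₀| ≤ (t₁ : ℝ) - t₀) {t : ℝ≥0} (ht : t₁ ≤ t) :
    leg q t₀ t₁ x t = x := by
  have h' : (t₀ : ℝ) ≤ t₁ := h
  have ht' : (t₁ : ℝ) ≤ t := ht
  rw [leg, min_eq_right (h.trans ht), max_eq_left (h'.trans ht'), min_eq_right ht']
  -- In a leg of duration zero the slope is a division by zero; `hx` then forces the two ends to
  -- coincide.
  rcases h'.eq_or_lt with he | hlt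
  · rw [he, sub_self, abs_nonpos_iff] at hx
    rw [hx, zero_div, zero_mul]
    linarith
  · rw [div_mul_cancel₀ _ (by linarith)]
    ring

theorem leg_isRoute (hq : IsRoute q) (h : t₀ ≤ t₁) (hx : |x - q t₀| ≤ (t₁ : ℝ) - t₀) :
    IsRoute (leg q t₀ t₁ x) := by
  have h' : (t₀ : ℝ) ≤ t₁ := h
  refine IsRoute.of_le (by rw [leg_of_le h zero_le, hq.start]) fun s t hst => ?_
  have hst' : (s : ℝ) ≤ t := hst
  have hm : |(x - q t₀) / (t₁ - t₀)| ≤ 1 := by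
    rw [abs_div, abs_of_nonneg (by linarith : (0 : ℝ) ≤ t₁ - t₀)]
    exact div_le_one_of_le₀ hx (by linarith)
  have h1 := hq.abs_sub_le (min s t₀) (min t t₀)
  rw [NNReal.coe_min, NNReal.coe_min] at h1
  unfold leg
  set m := (x - q t₀) / ((t₁ : ℝ) - t₀)
  have h2 : |m * (min (max (s : ℝ) t₀) t₁ - t₀) - m * (min (max (t : ℝ) t₀) t₁ - t₀)| ≤
      min (max (t : ℝ) t₀) t₁ - min (max (s : ℝ) t₀) t₁ := by
    have h3 : min (max (s : ℝ) t₀) t₁ ≤ min (max (t : ℝ) t₀) t₁ :=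
      min_le_min (max_le_max hst' le_rfl) le_rfl
    rw [← mul_sub, abs_mul, sub_sub_sub_cancel_right, abs_sub_comm,
      abs_of_nonneg (sub_nonneg.2 h3)]
    exact mul_le_of_le_one_left (sub_nonneg.2 h3) hm
  have h4 : |min (s : ℝ) t₀ - min (t : ℝ) t₀| = min (t : ℝ) t₀ - min (s : ℝ) t₀ := by
    rw [abs_sub_comm, abs_of_nonneg (sub_nonneg.2 (min_le_min hst' le_rfl))]
  rw [h4] at h1
  have h5 : min (max (t : ℝ) t₀) t₁ - min (max (s : ℝ) t₀) t₁ ≤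
      max (t : ℝ) t₀ - max (s : ℝ) t₀ := by
    rcases le_total (max (t : ℝ) t₀) t₁ with h6 | h6 <;>
    rcases le_total (max (s : ℝ) t₀) t₁ with h7 | h7 <;>
    simp only [min_eq_left, min_eq_right, h6, h7] <;>
    linarith [max_le_max hst' (le_refl (t₀ : ℝ))]
  -- The increments before and after t₀ add up to t - s, because min t t₀ + max t t₀ = t + t₀.
  have h8 := min_add_max (t : ℝ) t₀
  have h9 := min_add_max (s : ℝ) t₀
  rw [add_sub_add_comm]
  exact (abs_add_le _ _).trans (by linarith)

/-- Affine inequalities which hold at both ends of a leg hold along the leg. -/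
theorem leg_affine (h : t₀ ≤ t₁) {t : ℝ≥0} (h0 : t₀ ≤ t)
    (h1 : t ≤ t₁) (α β γ : ℝ) (e0 : α * t₀ + β * q t₀ ≤ γ) (e1 : α * t₁ + β * x ≤ γ) :
    α * t + β * leg q t₀ t₁ x t ≤ γ := by
  rcases h.eq_or_lt with he | hlt
  · have ht : t = t₀ := le_antisymm (h1.trans he.ge) h0
    rw [ht, leg_of_le h le_rfl]
    exact e0
  · have hlt' : (0 : ℝ) < t₁ - t₀ := sub_pos.2 hlt
    have h0' : (t₀ : ℝ) ≤ t := h0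
    have h1' : (t : ℝ) ≤ t₁ := h1
    rw [leg, min_eq_right h0, max_eq_left h0', min_eq_left h1']
    set θ := ((t : ℝ) - t₀) / (t₁ - t₀) with hθ
    have hθ0 : 0 ≤ θ := div_nonneg (by linarith) hlt'.le
    have hθ1 : θ ≤ 1 := div_le_one_of_le₀ (by linarith) hlt'.le
    have ht : (t : ℝ) = t₀ + θ * (t₁ - t₀) := by
      rw [hθ, div_mul_cancel₀ _ hlt'.ne']
      ring
    have hp : (x - q t₀) / ((t₁ : ℝ) - t₀) * (t - t₀) = θ * (x - q t₀) := by
      rw [hθ]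
      ring
    rw [hp, ht]
    have := mul_le_mul_of_nonneg_left e0 (sub_nonneg.2 hθ1)
    have := mul_le_mul_of_nonneg_left e1 hθ0
    linarith

end Leg

/-! ### Admissible states of the server -/

/-- The origin or the location of a request. -/
def IsPoint (σ : Finset Request) (x : ℝ) : Prop := x = 0 ∨ ∃ r ∈ σ, r.loc = x

theorem IsPoint.mono {σ σ' : Finset Request} {x : ℝ} (h : IsPoint σ x) (hσ : σ ⊆ σ') :
    IsPoint σ' x :=
  h.imp_right fun ⟨r, hr, hx⟩ => ⟨r, hσ hr, hx⟩

/-- Either nothing is pending to the left of the server at `p`, or the leftmost pending point `A`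
can be reached before its deadline, and the server is either close enough to `A` or has been
approaching it since its release. -/
def LeftSide (σ : Finset Request) (t p A B : ℝ) : Prop :=
  A = p ∨ ∃ l ∈ σ, l.loc = A ∧
    (∃ X, IsPoint σ X ∧ A ≤ X ∧ t + p - A ≤ 2.04 * l.time + 1.04 * (X - A)) ∧
    (p - A ≤ 1.04 * t + 0.04 * (B - A) ∨ t + p ≤ 1.6 * l.time)

/-- The mirror image of `LeftSide`. -/
def RightSide (σ : Finset Request) (t p A B : ℝ) : Prop :=
  B = p ∨ ∃ r ∈ σ, r.loc = B ∧
    (∃ X, IsPoint σ X ∧ X ≤ B ∧ t + B - p ≤ 2.04 * r.time + 1.04 * (B - X)) ∧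
    (B - p ≤ 1.04 * t + 0.04 * (B - A) ∨ t - p ≤ 1.6 * r.time)

/-- Admissible states: the server is at `p` at time `t` and the pending points lie in `[A, B]`. -/
structure State (σ : Finset Request) (t p A B : ℝ) : Prop where
  left_le : A ≤ p
  le_right : p ≤ B
  cone : |p| ≤ 0.6 * t
  hull_left : ∃ x, IsPoint σ x ∧ x ≤ p
  hull_right : ∃ x, IsPoint σ x ∧ p ≤ x
  left : LeftSide σ t p A B
  right : RightSide σ t p A B

theorem State.mono {σ σ' : Finset Request} {t p A B : ℝ} (h : State σ t p A B) (hσ : σ ⊆ σ') :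
    State σ' t p A B where
  left_le := h.left_le
  le_right := h.le_right
  cone := h.cone
  hull_left := h.hull_left.imp fun _ hx => ⟨hx.1.mono hσ, hx.2⟩
  hull_right := h.hull_right.imp fun _ hx => ⟨hx.1.mono hσ, hx.2⟩
  left := h.left.imp_right fun ⟨l, hl, h1, ⟨X, hX, h2⟩, h3⟩ =>
    ⟨l, hσ hl, h1, ⟨X, hX.mono hσ, h2⟩, h3⟩
  right := h.right.imp_right fun ⟨l, hl, h1, ⟨X, hX, h2⟩, h3⟩ =>
    ⟨l, hσ hl, h1, ⟨X, hX.mono hσ, h2⟩, h3⟩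

/-- If no further request arrives after time `t₀`, then the route `q` passes through admissible
states only and serves all requests in time. -/
def Good (σ : Finset Request) (t₀ : ℝ≥0) (q : ℝ≥0 → ℝ) : Prop :=
  IsRoute q ∧ ∃ (A B : ℝ≥0 → ℝ) (T : ℝ≥0), t₀ ≤ T ∧
    (∀ r ∈ σ, (∀ u ≤ t₀, ¬ ServedAt q r u) → r.loc ∈ Set.Icc (A t₀) (B t₀)) ∧
    (∀ t t', t₀ ≤ t → t ≤ t' → ∀ x ∈ Set.Icc (A t) (B t),
      x ∈ Set.Icc (A t') (B t') ∨ ∃ u, t ≤ u ∧ u ≤ t' ∧ q u = x) ∧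
    (∀ t, t₀ ≤ t → State σ t (q t) (A t) (B t)) ∧
    (∀ t, T ≤ t → A t = q t ∧ B t = q t) ∧
    ∀ M, FeasibleBy σ M → (T : ℝ) ≤ 2.04 * M

theorem good_empty : Good ∅ 0 fun _ => 0 := by
  refine ⟨⟨rfl, LipschitzWith.const' 0⟩, fun _ => 0, fun _ => 0, 0, le_rfl, by simp,
    fun t t' _ _ x hx => Or.inl hx, fun t _ => ?_, by simp, fun M hM => ?_⟩
  · exact ⟨le_rfl, le_rfl, by rw [abs_zero]; positivity, ⟨0, Or.inl rfl, le_rfl⟩, ⟨0, Or.inl rfl, le_rfl⟩,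
      Or.inl rfl, Or.inl rfl⟩
  · have := hM.1
    simp only [NNReal.coe_zero]
    positivity

/-- A point leaves the pending interval only by being visited, and at time T that interval has
shrunk to the position of the server. -/
theorem Good.served {σ : Finset Request} {t₀ : ℝ≥0} {q : ℝ≥0 → ℝ} (h : Good σ t₀ q)
    (hσ : ∀ r ∈ σ, r.time ≤ t₀) :
    ∃ T : ℝ≥0, (∀ r ∈ σ, ∃ u, ServedAt q r u ∧ u ≤ T) ∧
      ∀ M, FeasibleBy σ M → (T : ℝ) ≤ 2.04 * M := by
  obtain ⟨-, A, B, T, hT, h0, hs, -, hend, hM⟩ := h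
  refine ⟨T, fun r hr => ?_, hM⟩
  by_cases hu : ∃ u ≤ t₀, ServedAt q r u
  · obtain ⟨u, hu, hru⟩ := hu
    exact ⟨u, hru, hu.trans hT⟩
  · push Not at hu
    rcases hs t₀ T le_rfl hT _ (h0 r hr hu) with h1 | ⟨u, h1, h2, h3⟩
    · rw [(hend T le_rfl).1, (hend T le_rfl).2, Set.Icc_self] at h1
      exact ⟨T, ⟨(hσ r hr).trans hT, h1.symm⟩, le_rfl⟩
    · exact ⟨u, ⟨(hσ r hr).trans h1, h3⟩, h2⟩

/-! ### Reflection -/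

/-- The mirror image of a request. -/
def Request.reflect (r : Request) : Request := ⟨r.time, -r.loc⟩

open Classical in
/-- The mirror image of an input. -/
noncomputable def reflect (σ : Finset Request) : Finset Request := σ.image Request.reflect

@[simp] theorem Request.reflect_reflect (r : Request) : r.reflect.reflect = r := by
  simp [Request.reflect]

@[simp] theorem mem_reflect {σ : Finset Request} {r : Request} :
    r ∈ reflect σ ↔ r.reflect ∈ σ := by
  classical
  simp only [reflect, Finset.mem_image]
  exact ⟨fun ⟨a, ha, h⟩ => by rwa [← h, Request.reflect_reflect], fun h => ⟨_, h, by simp⟩⟩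

@[simp] theorem reflect_reflect (σ : Finset Request) : reflect (reflect σ) = σ := by
  ext r
  simp

theorem isRoute_neg {p : ℝ≥0 → ℝ} (h : IsRoute p) : IsRoute fun t => -p t :=
  ⟨by simp [h.start], h.speed.neg⟩

theorem servedAt_reflect {p : ℝ≥0 → ℝ} {r : Request} {t : ℝ≥0} :
    ServedAt (fun t => -p t) r t ↔ ServedAt p r.reflect t := by
  simp only [ServedAt, Request.reflect, neg_eq_iff_eq_neg]

theorem FeasibleBy.reflect {σ : Finset Request} {M : ℝ} (h : FeasibleBy σ M) :
    FeasibleBy (reflect σ) M := by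
  obtain ⟨h0, p, hp, h⟩ := h
  refine ⟨h0, _, isRoute_neg hp, fun r hr => ?_⟩
  obtain ⟨u, hu, huM⟩ := h _ (mem_reflect.1 hr)
  exact ⟨u, servedAt_reflect.2 hu, huM⟩

theorem IsPoint.reflect {σ : Finset Request} {x : ℝ} (h : IsPoint σ x) :
    IsPoint (reflect σ) (-x) := by
  rcases h with rfl | ⟨r, hr, rfl⟩
  · exact Or.inl (by simp)
  · exact Or.inr ⟨r.reflect, by simpa using hr, rfl⟩

theorem LeftSide.reflect {σ : Finset Request} {t p A B : ℝ} (h : LeftSide σ t p A B) :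
    RightSide (reflect σ) t (-p) (-B) (-A) := by
  rcases h with rfl | ⟨l, hl, rfl, ⟨X, hX, hAX, h1⟩, h2⟩
  · exact Or.inl rfl
  · refine Or.inr ⟨l.reflect, by simpa using hl, rfl, ⟨-X, hX.reflect, by linarith, ?_⟩, ?_⟩
    · simp only [Request.reflect]
      linarith
    · simp only [Request.reflect]
      exact h2.imp (fun h => by linarith) fun h => by linarith

theorem RightSide.reflect {σ : Finset Request} {t p A B : ℝ} (h : RightSide σ t p A B) :
    LeftSide (reflect σ) t (-p) (-B) (-A) := by
  rcases h with rfl | ⟨l, hl, rfl, ⟨X, hX, hAX, h1⟩, h2⟩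
  · exact Or.inl rfl
  · refine Or.inr ⟨l.reflect, by simpa using hl, rfl, ⟨-X, hX.reflect, by linarith, ?_⟩, ?_⟩
    · simp only [Request.reflect]
      linarith
    · simp only [Request.reflect]
      exact h2.imp (fun h => by linarith) fun h => by linarith

theorem State.reflect {σ : Finset Request} {t p A B : ℝ} (h : State σ t p A B) :
    State (reflect σ) t (-p) (-B) (-A) where
  left_le := neg_le_neg h.le_right
  le_right := neg_le_neg h.left_le
  cone := by simpa using h.cone
  hull_left := by
    obtain ⟨x, hx, h1⟩ := h.hull_right
    exact ⟨-x, hx.reflect, neg_le_neg h1⟩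
  hull_right := by
    obtain ⟨x, hx, h1⟩ := h.hull_left
    exact ⟨-x, hx.reflect, neg_le_neg h1⟩
  left := h.right.reflect
  right := h.left.reflect

theorem neg_mem_Icc {x a b : ℝ} : -x ∈ Set.Icc (-b) (-a) ↔ x ∈ Set.Icc a b := by
  simp [Set.mem_Icc, and_comm]

theorem Good.reflect {σ : Finset Request} {t₀ : ℝ≥0} {q : ℝ≥0 → ℝ} (h : Good σ t₀ q) :
    Good (reflect σ) t₀ fun t => -q t := by
  obtain ⟨hq, A, B, T, hT, h0, hs, hst, hend, hM⟩ := h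
  refine ⟨isRoute_neg hq, fun t => -B t, fun t => -A t, T, hT, fun r hr hu => ?_,
    fun t t' h1 h2 x hx => ?_, fun t ht => (hst t ht).reflect, fun t ht => ?_, fun M hM' => ?_⟩
  · have := h0 _ (mem_reflect.1 hr) fun u hut hu' => hu u hut (servedAt_reflect.2 hu')
    rw [← neg_mem_Icc] at this
    simpa [Request.reflect] using this
  · rw [← neg_neg x, neg_mem_Icc] at hx
    rcases hs t t' h1 h2 _ hx with h3 | ⟨u, h3, h4, h5⟩
    · left
      rw [← neg_neg x, neg_mem_Icc]
      exact h3
    · exact Or.inr ⟨u, h3, h4, by simp [h5]⟩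
  · simp [hend t ht]
  · have := hM'.reflect
    rw [reflect_reflect] at this
    exact hM M this

/-! ### Construction of good routes -/

/-- If the route `q` reaches the leftmost pending point at time `tL` through admissible states, then
it can be continued towards the rightmost pending point `r`. -/
theorem good_leg {σ : Finset Request} {q : ℝ≥0 → ℝ} (hq : IsRoute q) {t₀ tL tR : ℝ≥0}
    (h0L : t₀ ≤ tL) {r : Request} (hr : r ∈ σ)
    (hLR : q tL ≤ r.loc) (hT : r.loc - q tL ≤ (tR : ℝ) - tL)
    (hun : ∀ s ∈ σ, (∀ u ≤ t₀, ¬ ServedAt q s u) → s.loc ∈ Set.Icc (q tL) r.loc)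
    (hst : ∀ t, t₀ ≤ t → t ≤ tL → State σ t (q t) (q tL) r.loc)
    (hcone : |r.loc| ≤ 0.6 * tR)
    (hdead : ∃ X, IsPoint σ X ∧ X ≤ r.loc ∧ (tR : ℝ) ≤ 2.04 * r.time + 1.04 * (r.loc - X))
    (hV : 0.96 * (r.loc - q tL) ≤ 1.04 * tL ∨
      (tL : ℝ) - q tL ≤ 1.6 * r.time ∧ (tR : ℝ) - r.loc ≤ 1.6 * r.time)
    (hM : ∀ M, FeasibleBy σ M → (tR : ℝ) ≤ 2.04 * M) :
    Good σ t₀ (leg q tL tR r.loc) := by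
  have hLR' : tL ≤ tR := by
    rw [← NNReal.coe_le_coe]
    linarith
  have hLR'' : (tL : ℝ) ≤ tR := hLR'
  have hx : |r.loc - q tL| ≤ (tR : ℝ) - tL := by rwa [abs_of_nonneg (by linarith)]
  have hroute := leg_isRoute hq hLR' hx
  have hsL := hst tL h0L le_rfl
  have hend : ∀ t, tR ≤ t → leg q tL tR r.loc t = r.loc := fun t ht => leg_of_ge hLR' hx ht
  have hcL := abs_le.1 hsL.cone
  have hcR := abs_le.1 hcone
  have aff : ∀ t, tL ≤ t → t ≤ tR → ∀ α β γ : ℝ, α * tL + β * q tL ≤ γ →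
      α * tR + β * r.loc ≤ γ → α * t + β * leg q tL tR r.loc t ≤ γ :=
    fun t h1 h2 α β γ => leg_affine hLR' h1 h2 α β γ
  have hle : ∀ t, tL ≤ t → q tL ≤ leg q tL tR r.loc t ∧ leg q tL tR r.loc t ≤ r.loc := by
    intro t ht
    rcases le_total t tR with h | h
    · have := aff t ht h 0 1 r.loc (by linarith) (by linarith)
      have := aff t ht h 0 (-1) (-q tL) (by linarith) (by linarith)
      constructor <;> linarith
    · rw [hend t h]
      exact ⟨hLR, le_rfl⟩
  refine ⟨hroute, fun t => if t ≤ tL then q tL else leg q tL tR r.loc t, fun _ => r.loc, tR,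
    h0L.trans hLR', fun s hs hu => ?_, fun t t' h1 h2 x hx => ?_, fun t ht => ?_, fun t ht => ?_, hM⟩
  · simp only [h0L, if_true]
    refine hun s hs fun u hu' hsu => hu u hu' ⟨hsu.1, ?_⟩
    rw [leg_of_le hLR' (hu'.trans h0L)]
    exact hsu.2
  · by_cases hx' : (if t' ≤ tL then q tL else leg q tL tR r.loc t') ≤ x
    · exact Or.inl ⟨hx', hx.2⟩
    right
    push Not at hx'
    -- The left end at time t is the position of the server at time max t tL, so a point overtaken
    -- by the left end is crossed by the route, by the intermediate value theorem.
    have hA : leg q tL tR r.loc (max t tL) = if t ≤ tL then q tL else leg q tL tR r.loc t := by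
      split_ifs with h
      · rw [max_eq_right h, leg_of_le hLR' le_rfl]
      · rw [max_eq_left (not_le.1 h).le]
    by_cases ht' : t' ≤ tL
    · simp only [ht', h2.trans ht', if_true] at hx hx'
      exact absurd hx.1 (not_le.2 hx')
    · simp only [ht', if_false] at hx'
      obtain ⟨u, hu1, hu2, hu3⟩ := hroute.exists_eq (s := max t tL) (t := t')
        (max_le h2 (not_le.1 ht').le) (x := x)
        (Set.mem_uIcc.2 (Or.inl ⟨by rw [hA]; exact hx.1, hx'.le⟩))
      exact ⟨u, (le_max_left _ _).trans hu1, hu2, hu3⟩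
  · have ht' : (t₀ : ℝ) ≤ t := ht
    rcases le_or_gt t tL with h | h
    · simp only [h, if_true]
      rw [leg_of_le hLR' h]
      exact hst t ht h
    · simp only [not_le.2 h, if_false]
      have hb := hle t h.le
      have hpt : IsPoint σ r.loc := Or.inr ⟨r, hr, rfl⟩
      obtain ⟨x, hx1, hx2⟩ := hsL.hull_left
      refine ⟨le_rfl, hb.2, ?_, ⟨x, hx1, hx2.trans hb.1⟩, ⟨_, hpt, hb.2⟩, Or.inl rfl, ?_⟩
      · rcases le_total t tR with h' | h'
        · have := aff t h.le h' (-0.6) 1 0 (by linarith) (by linarith)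
          have := aff t h.le h' (-0.6) (-1) 0 (by linarith) (by linarith)
          exact abs_le.2 ⟨by linarith, by linarith⟩
        · rw [hend t h']
          have : (tR : ℝ) ≤ t := h'
          linarith
      · rcases le_total t tR with h' | h'
        · right
          obtain ⟨X, hX, hXr, hD⟩ := hdead
          refine ⟨r, hr, rfl, ⟨X, hX, hXr, ?_⟩, ?_⟩
          · have := aff t h.le h' 1 (-1) (tR - r.loc) (by linarith) (by linarith)
            linarith
          -- On this leg the left end is the server itself, so nearness reads 0.96 (r.loc - p) ≤
          -- 1.04 t. It holds at the start by `hV`, is trivial at the end where p = r.loc, and is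
          -- affine in between.
          · refine hV.imp (fun hV => ?_) fun hV => ?_
            · have := aff t h.le h' (-1.04) (-0.96) (-0.96 * r.loc) (by linarith)
                (by linarith [tR.2])
              linarith
            · have := aff t h.le h' 1 (-1) (1.6 * r.time) (by linarith) (by linarith)
              linarith
        · exact Or.inl (hend t h').symm
  · have : tL ≤ t := hLR'.trans ht
    constructor
    · show (if t ≤ tL then q tL else leg q tL tR r.loc t) = _
      split_ifs with h
      · have : t = tL := le_antisymm h this
        subst this
        rw [leg_of_le hLR' le_rfl]
      · rfl
    · exact (hend t ht).symm

/-- The states on a segment between the leftmost and the rightmost pending point are admissible if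
the states at both ends are. -/
theorem state_of_affine {σ : Finset Request} {l r : Request} (hl : l ∈ σ) (hr : r ∈ σ)
    {s₀ s₁ p₀ p₁ t p X : ℝ}
    (aff : ∀ α β γ : ℝ, α * s₀ + β * p₀ ≤ γ → α * s₁ + β * p₁ ≤ γ → α * t + β * p ≤ γ)
    (hL₀ : l.loc ≤ p₀) (hL₁ : l.loc ≤ p₁) (hR₀ : p₀ ≤ r.loc) (hR₁ : p₁ ≤ r.loc)
    (hc₀ : |p₀| ≤ 0.6 * s₀) (hc₁ : |p₁| ≤ 0.6 * s₁) (hX : IsPoint σ X) (hLX : l.loc ≤ X)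
    (hdL₀ : s₀ + p₀ - l.loc ≤ 2.04 * l.time + 1.04 * (X - l.loc))
    (hdL₁ : s₁ + p₁ - l.loc ≤ 2.04 * l.time + 1.04 * (X - l.loc))
    (hdR₀ : s₀ + r.loc - p₀ ≤ 2.04 * r.time + 1.04 * (r.loc - l.loc))
    (hdR₁ : s₁ + r.loc - p₁ ≤ 2.04 * r.time + 1.04 * (r.loc - l.loc))
    (hvL₀ : p₀ - l.loc ≤ 1.04 * s₀ + 0.04 * (r.loc - l.loc))
    (hvL₁ : p₁ - l.loc ≤ 1.04 * s₁ + 0.04 * (r.loc - l.loc))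
    (hvR : (r.loc - p₀ ≤ 1.04 * s₀ + 0.04 * (r.loc - l.loc) ∧
        r.loc - p₁ ≤ 1.04 * s₁ + 0.04 * (r.loc - l.loc)) ∨
      (s₀ - p₀ ≤ 1.6 * r.time ∧ s₁ - p₁ ≤ 1.6 * r.time)) :
    State σ t p l.loc r.loc := by
  have hpl : IsPoint σ l.loc := Or.inr ⟨l, hl, rfl⟩
  have hpr : IsPoint σ r.loc := Or.inr ⟨r, hr, rfl⟩
  have hLp : l.loc ≤ p := by linarith [aff 0 (-1) (-l.loc) (by linarith) (by linarith)]
  have hpR : p ≤ r.loc := by linarith [aff 0 1 r.loc (by linarith) (by linarith)]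
  rw [abs_le] at hc₀ hc₁
  refine ⟨hLp, hpR, abs_le.2 ⟨?_, ?_⟩, ⟨_, hpl, hLp⟩, ⟨_, hpr, hpR⟩,
    Or.inr ⟨l, hl, rfl, ⟨X, hX, hLX, ?_⟩, Or.inl ?_⟩,
    Or.inr ⟨r, hr, rfl, ⟨_, hpl, hLp.trans hpR, ?_⟩, hvR.imp (fun hv => ?_) fun hv => ?_⟩⟩
  · linarith [aff (-0.6) (-1) 0 (by linarith [hc₀.1]) (by linarith [hc₁.1])]
  · linarith [aff (-0.6) 1 0 (by linarith [hc₀.2]) (by linarith [hc₁.2])]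
  · linarith [aff 1 1 (2.04 * l.time + 1.04 * (X - l.loc) + l.loc) (by linarith) (by linarith)]
  · linarith [aff (-1.04) 1 (l.loc + 0.04 * (r.loc - l.loc)) (by linarith) (by linarith)]
  · linarith [aff 1 (-1) (2.04 * r.time + 1.04 * (r.loc - l.loc) - r.loc) (by linarith)
      (by linarith)]
  · linarith [aff (-1.04) (-1) (-r.loc + 0.04 * (r.loc - l.loc)) (by linarith) (by linarith)]
  · linarith [aff 1 (-1) (1.6 * r.time) (by linarith) (by linarith)]

/-- A server at `q t₀` moves to `w`, then to the leftmost pending point `l`, and then to the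
rightmost pending point `r`. -/
theorem exists_good_zigzag {σ : Finset Request} {q : ℝ≥0 → ℝ} (hq : IsRoute q)
    {t₀ t₁ tL tR : ℝ≥0} {w : ℝ} {l r : Request} (hl : l ∈ σ) (hr : r ∈ σ)
    (hun : ∀ s ∈ σ, (∀ u ≤ t₀, ¬ ServedAt q s u) → s.loc ∈ Set.Icc l.loc r.loc)
    (hLp : l.loc ≤ q t₀) (hpR : q t₀ ≤ r.loc) (hLw : l.loc ≤ w) (hwR : w ≤ r.loc)
    (h01 : |w - q t₀| ≤ (t₁ : ℝ) - t₀) (h1L : w - l.loc ≤ (tL : ℝ) - t₁)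
    (hLR : r.loc - l.loc ≤ (tR : ℝ) - tL)
    (hc0 : |q t₀| ≤ 0.6 * t₀) (hc1 : |w| ≤ 0.6 * t₁) (hcL : |l.loc| ≤ 0.6 * tL)
    (hcR : |r.loc| ≤ 0.6 * tR)
    (hdL : ∃ X, IsPoint σ X ∧ l.loc ≤ X ∧ (tL : ℝ) ≤ 2.04 * l.time + 1.04 * (X - l.loc))
    (hdR : (tR : ℝ) ≤ 2.04 * r.time + 1.04 * (r.loc - l.loc))
    (hL0 : q t₀ - l.loc ≤ 1.04 * t₀ + 0.04 * (r.loc - l.loc))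
    (hL1 : w - l.loc ≤ 1.04 * t₁ + 0.04 * (r.loc - l.loc))
    (hR0 : t₁ - w ≤ 1.6 * r.time)
    (hR1 : r.loc - w ≤ 1.04 * t₁ + 0.04 * (r.loc - l.loc))
    (hM : ∀ M, FeasibleBy σ M → (tR : ℝ) ≤ 2.04 * M) :
    ∃ q', (∀ t ≤ t₀, q' t = q t) ∧ Good σ t₀ q' := by
  have h01' : t₀ ≤ t₁ := by
    rw [← NNReal.coe_le_coe]
    linarith [abs_nonneg (w - q t₀)]
  have h1L' : t₁ ≤ tL := by
    rw [← NNReal.coe_le_coe]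
    linarith
  have h01'' : (t₀ : ℝ) ≤ t₁ := h01'
  have h1L'' : (t₁ : ℝ) ≤ tL := h1L'
  set q₁ := leg q t₀ t₁ w with hq₁
  have hr1 : IsRoute q₁ := leg_isRoute hq h01' h01
  have hw : q₁ t₁ = w := leg_of_ge h01' h01 le_rfl
  have h1L3 : |l.loc - q₁ t₁| ≤ (tL : ℝ) - t₁ := by
    rw [hw, abs_sub_comm, abs_of_nonneg (by linarith)]
    exact h1L
  set q₂ := leg q₁ t₁ tL l.loc with hq₂
  have hr2 : IsRoute q₂ := leg_isRoute hr1 h1L' h1L3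
  have hL : q₂ tL = l.loc := leg_of_ge h1L' h1L3 le_rfl
  have hagree : ∀ t ≤ t₀, q₂ t = q t := fun t ht => by
    rw [hq₂, leg_of_le h1L' (ht.trans h01'), hq₁, leg_of_le h01' ht]
  have hLR' : tL ≤ tR := by
    rw [← NNReal.coe_le_coe]
    linarith
  obtain ⟨X, hX, hLX, hdX⟩ := hdL
  have hpl : IsPoint σ l.loc := Or.inr ⟨l, hl, rfl⟩
  have hpr : IsPoint σ r.loc := Or.inr ⟨r, hr, rfl⟩
  have m := abs_le.1 h01
  refine ⟨leg q₂ tL tR r.loc, fun t ht => ?_, good_leg hr2 (h01'.trans h1L') hr ?_ ?_ ?_ ?_ hcR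
    ⟨l.loc, hpl, by linarith, hdR⟩ ?_ hM⟩
  · rw [leg_of_le hLR' (ht.trans (h01'.trans h1L')), hagree t ht]
  · rw [hL]
    linarith
  · rw [hL]
    exact hLR
  · rw [hL]
    exact fun s hs hu => hun s hs fun u hut hsu =>
      hu u hut ⟨hsu.1, by rw [hagree u hut]; exact hsu.2⟩
  · intro t ht0 htL
    rw [hL]
    -- Until t₁ the condition for the right end is t - p ≤ 1.6 r.time, which follows from `hR0`.
    -- Afterwards the server may retreat from r, and nearness at time t₁, from `hR1`, takes over.
    rcases le_total t t₁ with h | h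
    · rw [hq₂, leg_of_le h1L' h]
      refine state_of_affine hl hr
        (fun α β γ => leg_affine h01' ht0 h α β γ) hLp hLw hpR hwR hc0 hc1
        hX hLX ?_ ?_ ?_ ?_ hL0 hL1 (Or.inr ⟨?_, hR0⟩) <;> linarith
    · refine state_of_affine hl hr
        (fun α β γ h1 h2 => leg_affine h1L' h htL α β γ (by rw [hw]; exact h1) h2)
        hLw le_rfl hwR (by linarith) hc1 hcL hX hLX ?_ ?_ ?_ ?_ hL1 ?_ (Or.inl ⟨hR1, ?_⟩)
      · linarith
      · linarith
      · linarith
      · linarith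
      · linarith [tL.2, show (0:ℝ) ≤ (tL:ℝ) from tL.2]
      · linarith
  · left
    rw [hL]
    linarith

/-! ### Lower bounds for feasible makespans -/

/-- Only the service times matter for lower bounds: a case distinction on the order of service and
linear arithmetic then suffice. -/
theorem FeasibleBy.exists_times {σ : Finset Request} {M : ℝ} (h : FeasibleBy σ M) :
    ∃ u : Request → ℝ, (∀ r ∈ σ, (r.time : ℝ) ≤ u r ∧ u r ≤ M ∧ |r.loc| ≤ u r) ∧
      ∀ r ∈ σ, ∀ s ∈ σ, |r.loc - s.loc| ≤ |u r - u s| := by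
  obtain ⟨-, p, hp, h⟩ := h
  choose! u hu huM using h
  refine ⟨fun r => u r, fun r hr => ⟨(hu r hr).1, huM r hr, ?_⟩, fun r hr s hs => ?_⟩
  · have := hp.abs_sub_le (u r) 0
    rwa [(hu r hr).2, hp.start, sub_zero, NNReal.coe_zero, sub_zero,
      abs_of_nonneg (u r).coe_nonneg] at this
  · rw [← (hu r hr).2, ← (hu s hs).2]
    exact hp.abs_sub_le _ _

theorem FeasibleBy.time_le {σ : Finset Request} {M : ℝ} (h : FeasibleBy σ M) {r : Request}
    (hr : r ∈ σ) : (r.time : ℝ) ≤ M := by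
  obtain ⟨u, hu, -⟩ := h.exists_times
  exact (hu r hr).1.trans (hu r hr).2.1

/-- Whichever of the two is served first is served no earlier than `l.time`, and the trip to the
other follows. -/
theorem FeasibleBy.time_add_le {σ : Finset Request} {M : ℝ} (h : FeasibleBy σ M) {l r : Request}
    (hl : l ∈ σ) (hr : r ∈ σ) (hlr : l.time ≤ r.time) : l.time + (r.loc - l.loc) ≤ M := by
  obtain ⟨u, hu, huu⟩ := h.exists_times
  have hlr' : (l.time : ℝ) ≤ r.time := hlr
  have h1 := hu l hl
  have h2 := hu r hr
  have h3 := (le_abs_self _).trans (huu r hr l hl)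
  rcases le_abs.1 h3 with h4 | h4 <;> linarith

/-- If the leftmost pending point `l` can be reached before its deadline, then serving `l` first and
a new request `r` on the right last is fast enough. -/
theorem FeasibleBy.switch_bound {σ : Finset Request} {M : ℝ} (h : FeasibleBy σ M) {l r : Request}
    (hl : l ∈ σ) (hr : r ∈ σ) (hlr : l.time ≤ r.time) {X p : ℝ} (hX : IsPoint σ X)
    (hLX : l.loc ≤ X) (hpr : p ≤ r.loc)
    (hd : r.time + p - l.loc ≤ 2.04 * l.time + 1.04 * (X - l.loc)) :
    r.time + (p - l.loc) + (r.loc - l.loc) ≤ 2.04 * M := by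
  obtain ⟨u, hu, huu⟩ := h.exists_times
  have hlr' : (l.time : ℝ) ≤ r.time := hlr
  have hl0 : (0 : ℝ) ≤ l.time := l.time.2
  have h1 := hu l hl
  have h2 := hu r hr
  rcases le_abs.1 ((le_abs_self _).trans (huu r hr l hl)) with h3 | h3
  · rcases hX with rfl | ⟨x, hx, rfl⟩
    · have := neg_abs_le l.loc
      linarith
    · have h4 := hu x hx
      have h5 := x.time.2
      have h6 : (0 : ℝ) ≤ x.time := h5
      rcases le_abs.1 ((le_abs_self _).trans (huu x hx l hl)) with h7 | h7
      -- Here l precedes both r and X. Adding M ≥ u l + (r.loc - l.loc) to 1.04 times M ≥ u l + (X -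
      -- l.loc) gives exactly the deadline of l plus the final crossing.
      · linarith
      · linarith
  · linarith

/-! ### A new request to the right of all pending points -/

section NewRequest

variable {σ : Finset Request} {q : ℝ≥0 → ℝ} {r : Request} {A B : ℝ}

/-- With nothing pending on the left, the server heads for r, slowly enough to arrive inside the
cone. This is on time because some point lies at or to the left of the server, so every offline
route travels at least r.loc - p and also waits for r. -/
theorem exists_good_straight (hq : IsRoute q) (hr : r ∈ σ)
    (hrl : |r.loc| ≤ r.time) (hst : State σ r.time (q r.time) A B)
    (hun : ∀ s ∈ σ, (∀ u ≤ r.time, ¬ ServedAt q s u) → s.loc ∈ Set.Icc (q r.time) r.loc)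
    (hpr : q r.time ≤ r.loc) : ∃ q', (∀ t ≤ r.time, q' t = q t) ∧ Good σ r.time q' := by
  have hc := abs_le.1 hst.cone
  have hrl' := abs_le.1 hrl
  have ht : (0 : ℝ) ≤ r.time := r.time.2
  obtain ⟨tR, htR⟩ : ∃ tR : ℝ≥0, (tR : ℝ) =
      max (r.time + (r.loc - q r.time)) (r.loc * (5 / 3)) :=
    ⟨⟨_, le_max_of_le_left (by linarith)⟩, rfl⟩
  have h1 : (r.time : ℝ) + (r.loc - q r.time) ≤ tR := by rw [htR]; exact le_max_left _ _
  have h2 : r.loc * (5 / 3) ≤ tR := by rw [htR]; exact le_max_right _ _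
  have hle : ∀ y : ℝ, r.time + (r.loc - q r.time) ≤ y → r.loc * (5 / 3) ≤ y → (tR : ℝ) ≤ y :=
    fun y e1 e2 => by rw [htR]; exact max_le e1 e2
  have htR' : r.time ≤ tR := by
    rw [← NNReal.coe_le_coe]
    linarith
  have hpt : IsPoint σ r.loc := Or.inr ⟨r, hr, rfl⟩
  refine ⟨leg q r.time tR r.loc, fun t ht => leg_of_le htR' ht,
    good_leg hq le_rfl hr hpr (by linarith) hun ?_ ?_ ?_ (Or.inr ⟨?_, ?_⟩) fun M hM => ?_⟩
  · intro t h3 h4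
    obtain rfl : t = r.time := le_antisymm h4 h3
    refine ⟨le_rfl, hpr, hst.cone, hst.hull_left, ⟨_, hpt, hpr⟩, Or.inl rfl,
      Or.inr ⟨r, hr, rfl, ?_, Or.inr (by linarith)⟩⟩
    rcases le_total 0 r.loc with h0 | h0
    · exact ⟨0, Or.inl rfl, h0, by linarith⟩
    · exact ⟨r.loc, hpt, le_rfl, by linarith⟩
  · exact abs_le.2 ⟨by linarith, by linarith⟩
  · rcases le_total 0 r.loc with h0 | h0
    · exact ⟨0, Or.inl rfl, h0, hle _ (by linarith) (by linarith)⟩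
    · exact ⟨r.loc, hpt, le_rfl, hle _ (by linarith) (by linarith)⟩
  · linarith
  · have := hle (1.6 * r.time + r.loc) (by linarith) (by linarith)
    linarith
  · have hMt := hM.time_le hr
    refine hle _ ?_ (by linarith)
    obtain ⟨x, hx, hxp⟩ := hst.hull_left
    rcases hx with rfl | ⟨x, hx, rfl⟩
    · linarith
    · obtain ⟨u, hu, huu⟩ := hM.exists_times
      have h3 := hu x hx
      have h4 := hu r hr
      have h5 := neg_abs_le x.loc
      rcases le_abs.1 ((le_abs_self _).trans (huu r hr x hx)) with h6 | h6 <;> linarith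

variable {l : Request} {X : ℝ}

/-- Serve the leftmost pending point first and the new request last. -/
theorem exists_good_new_last (hq : IsRoute q) (hl : l ∈ σ) (hr : r ∈ σ)
    (hll : |l.loc| ≤ l.time) (hrl : |r.loc| ≤ r.time) (hlr : l.time ≤ r.time)
    (hc : |q r.time| ≤ 0.6 * r.time)
    (hun : ∀ s ∈ σ, (∀ u ≤ r.time, ¬ ServedAt q s u) → s.loc ∈ Set.Icc l.loc r.loc)
    (hLp : l.loc ≤ q r.time) (hpr : q r.time ≤ r.loc) (hX : IsPoint σ X) (hLX : l.loc ≤ X)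
    (hd : r.time + q r.time - l.loc ≤ 2.04 * l.time + 1.04 * (X - l.loc))
    (hL : q r.time - l.loc ≤ 1.04 * r.time + 0.04 * (r.loc - l.loc)) :
    ∃ q', (∀ t ≤ r.time, q' t = q t) ∧ Good σ r.time q' := by
  have hc' := abs_le.1 hc
  have hll' := abs_le.1 hll
  have hrl' := abs_le.1 hrl
  have hl0 : (0 : ℝ) ≤ l.time := l.time.2
  have hlr' : (l.time : ℝ) ≤ r.time := hlr
  set p := q r.time with hp
  -- The least time of moving towards r after which the server is near r: both sides of r.loc - (p +
  -- s) ≤ 1.04 (r.time + s) + 0.04 (r.loc - l.loc) depend on s, whence 2.04.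
  set s := max 0 ((r.loc - p - 1.04 * r.time - 0.04 * (r.loc - l.loc)) / 2.04) with hs
  have hs0 : 0 ≤ s := le_max_left _ _
  have hs1 : r.loc - p - 1.04 * r.time - 0.04 * (r.loc - l.loc) ≤ 2.04 * s := by
    have := le_max_right 0 ((r.loc - p - 1.04 * r.time - 0.04 * (r.loc - l.loc)) / 2.04)
    rw [div_le_iff₀ (by norm_num)] at this
    linarith
  have hs2 : s = 0 ∨ 2.04 * s = r.loc - p - 1.04 * r.time - 0.04 * (r.loc - l.loc) := by
    rcases max_choice 0 ((r.loc - p - 1.04 * r.time - 0.04 * (r.loc - l.loc)) / 2.04) with h | h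
    · exact Or.inl h
    · right
      rw [hs, h]
      ring
  clear_value s
  obtain ⟨t₁, ht₁⟩ : ∃ t₁ : ℝ≥0, (t₁ : ℝ) = r.time + s := ⟨⟨_, by linarith⟩, rfl⟩
  -- The factor 5/3 = 1/0.6 delays the arrival until l lies in the cone.
  obtain ⟨tL, htL⟩ : ∃ tL : ℝ≥0, (tL : ℝ) = max (t₁ + (p + s - l.loc)) (-l.loc * (5 / 3)) :=
    ⟨⟨_, le_max_of_le_left (by linarith)⟩, rfl⟩
  have htL1 : t₁ + (p + s - l.loc) ≤ tL := by rw [htL]; exact le_max_left _ _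
  have htL2 : -l.loc * (5 / 3) ≤ tL := by rw [htL]; exact le_max_right _ _
  have hleL : ∀ y : ℝ, t₁ + (p + s - l.loc) ≤ y → -l.loc * (5 / 3) ≤ y → (tL : ℝ) ≤ y :=
    fun y e1 e2 => by rw [htL]; exact max_le e1 e2
  obtain ⟨tR, htR⟩ : ∃ tR : ℝ≥0, (tR : ℝ) = max (tL + (r.loc - l.loc)) (r.loc * (5 / 3)) :=
    ⟨⟨_, le_max_of_le_left (by linarith [show (0 : ℝ) ≤ tL from tL.2])⟩, rfl⟩
  have htR1 : tL + (r.loc - l.loc) ≤ tR := by rw [htR]; exact le_max_left _ _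
  have htR2 : r.loc * (5 / 3) ≤ tR := by rw [htR]; exact le_max_right _ _
  have hleR : ∀ y : ℝ, tL + (r.loc - l.loc) ≤ y → r.loc * (5 / 3) ≤ y → (tR : ℝ) ≤ y :=
    fun y e1 e2 => by rw [htR]; exact max_le e1 e2
  clear htL htR
  have hpt : IsPoint σ r.loc := Or.inr ⟨r, hr, rfl⟩
  refine exists_good_zigzag hq (t₁ := t₁) (tL := tL) (tR := tR) (w := p + s) hl hr hun hLp hpr
    (by linarith) ?_ ?_ (by linarith) (by linarith) hc ?_ ?_ ?_ ?_ ?_ hL ?_ ?_ ?_ fun M hM => ?_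
  · rcases hs2 with h | h <;> linarith
  · rw [add_sub_cancel_left, abs_of_nonneg hs0]
    linarith
  · rcases hs2 with h | h <;> exact abs_le.2 ⟨by linarith, by linarith⟩
  · exact abs_le.2 ⟨by linarith, by linarith⟩
  · exact abs_le.2 ⟨by linarith, by linarith⟩
  -- Without the detour the old witness X for the deadline of l survives; with it, r is far enough
  -- away to be the witness.
  · rcases hs2 with h | h
    · exact ⟨X, hX, hLX, hleL _ (by linarith) (by linarith)⟩
    · exact ⟨r.loc, hpt, by linarith, hleL _ (by linarith) (by linarith)⟩
  · have : (tL : ℝ) ≤ 2.04 * r.time + 0.04 * (r.loc - l.loc) := by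
      rcases hs2 with h | h <;> exact hleL _ (by linarith) (by linarith)
    exact hleR _ (by linarith) (by linarith)
  · rcases hs2 with h | h <;> linarith
  · linarith
  · linarith
  · have hM1 := hM.time_le hr
    have hM2 := hM.time_add_le hl hr hlr
    refine hleR _ ?_ (by linarith)
    have : (tL : ℝ) ≤ 2.04 * M - (r.loc - l.loc) := by
      rcases hs2 with h | h
      · have := hM.switch_bound hl hr hlr hX hLX hpr hd
        exact hleL _ (by linarith) (by linarith)
      · exact hleL _ (by linarith) (by linarith)
    linarith

/-- Approach the leftmost pending point for a while, and then serve the new request first. -/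
theorem exists_good_new_first (hq : IsRoute q) (hl : l ∈ σ) (hr : r ∈ σ)
    (hll : |l.loc| ≤ l.time) (hrl : |r.loc| ≤ r.time) (hlr : l.time ≤ r.time)
    (hc : |q r.time| ≤ 0.6 * r.time)
    (hun : ∀ s ∈ σ, (∀ u ≤ r.time, ¬ ServedAt q s u) → s.loc ∈ Set.Icc l.loc r.loc)
    (hLp : l.loc ≤ q r.time) (hpr : q r.time ≤ r.loc)
    (hw : r.time + q r.time ≤ 1.6 * l.time)
    (hL : 1.04 * r.time + 0.04 * (r.loc - l.loc) < q r.time - l.loc) :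
    ∃ q', (∀ t ≤ r.time, q' t = q t) ∧ Good σ r.time q' := by
  have hc' := abs_le.1 hc
  have hll' := abs_le.1 hll
  have hrl' := abs_le.1 hrl
  have hl0 : (0 : ℝ) ≤ l.time := l.time.2
  have hlr' : (l.time : ℝ) ≤ r.time := hlr
  set p := q r.time with hp
  -- Approaching l for time s makes nearness to l an equality; only then does the server turn to r.
  obtain ⟨s, hs⟩ : ∃ s, 2.04 * s = p - l.loc - 1.04 * r.time - 0.04 * (r.loc - l.loc) :=
    ⟨(p - l.loc - 1.04 * r.time - 0.04 * (r.loc - l.loc)) / 2.04, by ring⟩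
  have hs0 : 0 < s := by linarith
  obtain ⟨t₁, ht₁⟩ : ∃ t₁ : ℝ≥0, (t₁ : ℝ) = r.time + s := ⟨⟨_, by linarith⟩, rfl⟩
  obtain ⟨tR, htR⟩ : ∃ tR : ℝ≥0, (tR : ℝ) = max (t₁ + (r.loc - (p - s))) (r.loc * (5 / 3)) :=
    ⟨⟨_, le_max_of_le_left (by linarith)⟩, rfl⟩
  have htR1 : t₁ + (r.loc - (p - s)) ≤ tR := by rw [htR]; exact le_max_left _ _
  have htR2 : r.loc * (5 / 3) ≤ tR := by rw [htR]; exact le_max_right _ _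
  have hleR : ∀ y : ℝ, t₁ + (r.loc - (p - s)) ≤ y → r.loc * (5 / 3) ≤ y → (tR : ℝ) ≤ y :=
    fun y e1 e2 => by rw [htR]; exact max_le e1 e2
  obtain ⟨tL, htL⟩ : ∃ tL : ℝ≥0, (tL : ℝ) = max (tR + (r.loc - l.loc)) (-l.loc * (5 / 3)) :=
    ⟨⟨_, le_max_of_le_left (by linarith [show (0 : ℝ) ≤ tR from tR.2])⟩, rfl⟩
  have htL1 : tR + (r.loc - l.loc) ≤ tL := by rw [htL]; exact le_max_left _ _
  have htL2 : -l.loc * (5 / 3) ≤ tL := by rw [htL]; exact le_max_right _ _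
  have hleL : ∀ y : ℝ, tR + (r.loc - l.loc) ≤ y → -l.loc * (5 / 3) ≤ y → (tL : ℝ) ≤ y :=
    fun y e1 e2 => by rw [htL]; exact max_le e1 e2
  clear htL htR
  -- Being far from l (`hL`) although approaching it since its release (`hw`) forces r.time < 1.3
  -- l.time, so the detour to r is affordable.
  have hdl : (tL : ℝ) ≤ 2.04 * l.time + 1.04 * (r.loc - l.loc) := by
    have : (tR : ℝ) ≤ 2.04 * l.time + 0.04 * (r.loc - l.loc) :=
      hleR _ (by linarith) (by linarith)
    exact hleL _ (by linarith) (by linarith)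
  -- In the mirror image r is the end served first. The origin witnesses its deadline: `hL` and
  -- |l.loc| ≤ r.time give p > 0, so r lies on the positive side.
  obtain ⟨q', hq', hg⟩ := exists_good_zigzag (σ := reflect σ) (q := fun t => -q t)
    (isRoute_neg hq) (t₀ := r.time) (t₁ := t₁) (tL := tR) (tR := tL) (w := -(p - s))
    (l := r.reflect) (r := l.reflect) (by simpa using hr) (by simpa using hl)
    (fun x hx hu => by
      have := hun _ (mem_reflect.1 hx) fun u hut hu' => hu u hut (servedAt_reflect.2 hu')
      rw [← neg_mem_Icc] at this
      simpa [Request.reflect] using this)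
    (neg_le_neg hpr) (neg_le_neg hLp) (neg_le_neg (by linarith)) (neg_le_neg (by linarith))
    (by rw [← hp, neg_sub_neg, sub_sub_cancel, abs_of_nonneg hs0.le]; linarith)
    (by simp only [Request.reflect]; linarith) (by simp only [Request.reflect]; linarith)
    (by rw [abs_neg]; exact hc) (by rw [abs_neg]; exact abs_le.2 ⟨by linarith, by linarith⟩)
    (by simp only [Request.reflect, abs_neg]; exact abs_le.2 ⟨by linarith, by linarith⟩)
    (by simp only [Request.reflect, abs_neg]; exact abs_le.2 ⟨by linarith, by linarith⟩)
    ⟨0, Or.inl rfl, by simp only [Request.reflect]; linarith, by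
      simp only [Request.reflect]
      exact hleR _ (by linarith) (by linarith)⟩
    (by simp only [Request.reflect]; linarith) (by simp only [Request.reflect]; linarith)
    (by simp only [Request.reflect]; linarith) (by simp only [Request.reflect]; linarith)
    (by simp only [Request.reflect]; linarith)
    (fun M hM => by
      have hM' := hM.reflect
      rw [reflect_reflect] at hM'
      linarith [hM'.time_add_le hl hr hlr])
  refine ⟨fun t => -q' t, fun t ht => by simp [hq' t ht], ?_⟩
  have := hg.reflect
  rwa [reflect_reflect] at this

open Classical in
-- Nearness to l in the enlarged interval decides which end is served first. If it fails, it failed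
-- in the smaller interval too, so the other alternative of `LeftSide` is available.
theorem exists_good_insert_right (hq : IsRoute q)
    (hσ : ∀ s ∈ σ, |s.loc| ≤ s.time ∧ s.time ≤ r.time) (hrl : |r.loc| ≤ r.time)
    (hst : State σ r.time (q r.time) A B)
    (hun : ∀ s ∈ σ, (∀ u ≤ r.time, ¬ ServedAt q s u) → s.loc ∈ Set.Icc A B) (hB : B < r.loc) :
    ∃ q', (∀ t ≤ r.time, q' t = q t) ∧ Good (insert r σ) r.time q' := by
  have hst' := hst.mono (Finset.subset_insert r σ)
  have hun' : ∀ s ∈ insert r σ, (∀ u ≤ r.time, ¬ ServedAt q s u) → s.loc ∈ Set.Icc A r.loc := by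
    intro s hs hu
    rcases Finset.mem_insert.1 hs with rfl | hs
    · exact ⟨(hst.left_le.trans hst.le_right).trans hB.le, le_rfl⟩
    · exact ⟨(hun s hs hu).1, (hun s hs hu).2.trans hB.le⟩
  have hr := Finset.mem_insert_self r σ
  have hpr : q r.time ≤ r.loc := hst.le_right.trans hB.le
  rcases hst.left with rfl | ⟨l, hl, rfl, ⟨X, hX, hLX, hd⟩, hV⟩
  · exact exists_good_straight hq hr hrl hst' hun' hpr
  · have hl' := Finset.mem_insert_of_mem (b := r) hl
    by_cases hL : q r.time - l.loc ≤ 1.04 * r.time + 0.04 * (r.loc - l.loc)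
    · exact exists_good_new_last hq hl' hr (hσ l hl).1 hrl (hσ l hl).2 hst.cone hun' hst.left_le
        hpr (hX.mono (Finset.subset_insert r σ)) hLX hd hL
    · refine exists_good_new_first hq hl' hr (hσ l hl).1 hrl (hσ l hl).2 hst.cone hun' hst.left_le
        hpr (hV.resolve_left fun h => hL ?_) (not_le.1 hL)
      linarith

end NewRequest

/-! ### A competitive algorithm for the original model -/

open Classical in
theorem Good.exists_insert {σ : Finset Request} {q : ℝ≥0 → ℝ} {t₀ : ℝ≥0} (h : Good σ t₀ q)
    {r : Request} (hσ : ∀ s ∈ σ, |s.loc| ≤ s.time ∧ s.time ≤ t₀) (hr : |r.loc| ≤ r.time)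
    (ht : t₀ ≤ r.time) :
    ∃ q', (∀ t ≤ r.time, q' t = q t) ∧ Good (insert r σ) r.time q' := by
  obtain ⟨hq, A, B, T, hT, h0, hs, hst, hend, hM⟩ := h
  have hσ' : ∀ s ∈ σ, |s.loc| ≤ s.time ∧ s.time ≤ r.time := fun s hs =>
    ⟨(hσ s hs).1, (hσ s hs).2.trans ht⟩
  have hun : ∀ s ∈ σ, (∀ u ≤ r.time, ¬ ServedAt q s u) →
      s.loc ∈ Set.Icc (A r.time) (B r.time) := by
    intro s hsσ hu
    rcases hs t₀ r.time le_rfl ht _ (h0 s hsσ fun u hut => hu u (hut.trans ht)) with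
      h1 | ⟨u, h1, h2, h3⟩
    · exact h1
    · exact absurd ⟨(hσ s hsσ).2.trans h1, h3⟩ (hu u h2)
  rcases lt_or_ge (B r.time) r.loc with hB | hB
  · exact exists_good_insert_right hq hσ' hr (hst _ ht) hun hB
  rcases lt_or_ge r.loc (A r.time) with hA | hA
  · obtain ⟨q', hq', hg⟩ := exists_good_insert_right (σ := LineTSP.reflect σ) (q := fun t => -q t)
      (r := r.reflect) (A := -B r.time) (B := -A r.time) (isRoute_neg hq)
      (fun s hs => by simpa [Request.reflect] using hσ' _ (mem_reflect.1 hs))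
      (by simpa [Request.reflect] using hr) (hst _ ht).reflect
      (fun s hs hu => by
        have := hun _ (mem_reflect.1 hs) fun u hut hu' => hu u hut (servedAt_reflect.2 hu')
        rw [← neg_mem_Icc] at this
        simpa [Request.reflect] using this) (neg_lt_neg hA)
    refine ⟨fun t => -q' t, fun t ht => by simp [hq' t ht], ?_⟩
    have := hg.reflect
    have he : LineTSP.reflect (insert r.reflect (LineTSP.reflect σ)) = insert r σ := by
      ext s
      simp only [mem_reflect, Finset.mem_insert, Request.reflect_reflect]
      refine or_congr_left ⟨fun h => ?_, fun h => by rw [h]⟩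
      rw [← s.reflect_reflect, h, r.reflect_reflect]
    rwa [he] at this
  · refine ⟨q, fun _ _ => rfl, hq, A, B, max T r.time, le_max_right _ _, fun s hs hu => ?_,
      fun t t' h1 h2 => hs t t' (ht.trans h1) h2,
      fun t h1 => (hst t (ht.trans h1)).mono (Finset.subset_insert _ _),
      fun t h1 => hend t ((le_max_left _ _).trans h1), fun M hM' => ?_⟩
    · rcases Finset.mem_insert.1 hs with rfl | hs
      · exact ⟨hA, hB⟩
      · exact hun s hs hu
    · rw [NNReal.coe_max]
      have := hM'.time_le (Finset.mem_insert_self _ _)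
      exact max_le (hM M (hM'.mono (Finset.subset_insert _ _))) (by linarith [hM'.1])

theorem Good.exists_union {σ : Finset Request} {q : ℝ≥0 → ℝ} {t₀ τ : ℝ≥0} (h : Good σ t₀ q)
    (hσ : ∀ s ∈ σ, |s.loc| ≤ s.time ∧ s.time ≤ t₀) (hτ : t₀ ≤ τ) {σ' : Finset Request}
    (hσ' : ∀ s ∈ σ', |s.loc| ≤ s.time) (hsub : σ ⊆ σ') (hne : σ ≠ σ')
    (hnew : ∀ s ∈ σ', s ∉ σ → s.time = τ) :
    ∃ q', (∀ t ≤ τ, q' t = q t) ∧ Good σ' τ q' := by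
  classical
  induction hn : (σ' \ σ).card generalizing σ q t₀ with
  | zero =>
    rw [Finset.card_eq_zero, Finset.sdiff_eq_empty_iff_subset] at hn
    exact absurd (hsub.antisymm hn) hne
  | succ n ih =>
    obtain ⟨r, hr⟩ : (σ' \ σ).Nonempty := Finset.card_pos.1 (by omega)
    rw [Finset.mem_sdiff] at hr
    have hrt := hnew r hr.1 hr.2
    obtain ⟨q₁, hq₁, hg⟩ := h.exists_insert hσ (hσ' r hr.1) (hrt ▸ hτ)
    rw [hrt] at hq₁ hg
    have hsub' : insert r σ ⊆ σ' := Finset.insert_subset hr.1 hsub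
    by_cases he : insert r σ = σ'
    · exact ⟨q₁, hq₁, he ▸ hg⟩
    · obtain ⟨q₂, hq₂, hg₂⟩ := ih hg (fun s hs => by
          rcases Finset.mem_insert.1 hs with rfl | hs
          · exact ⟨hσ' _ hr.1, hrt.le⟩
          · exact ⟨(hσ s hs).1, (hσ s hs).2.trans hτ⟩) le_rfl hsub' he
        (fun s hs hs' => hnew s hs fun h => hs' (Finset.mem_insert_of_mem h)) (by
          rw [Finset.sdiff_insert, Finset.card_erase_of_mem (Finset.mem_sdiff.2 hr), hn]
          rfl)
      exact ⟨q₂, fun t ht => (hq₂ t ht).trans (hq₁ t ht), hg₂⟩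

/-- The requests released before the last release time. -/
noncomputable def earlier (σ : Finset Request) : Finset Request :=
  σ.filter fun r => r.time < lastRelease σ

theorem time_le_lastRelease {σ : Finset Request} {r : Request} (hr : r ∈ σ) :
    r.time ≤ lastRelease σ := Finset.le_sup hr

theorem exists_time_eq_lastRelease {σ : Finset Request} (h : σ.Nonempty) :
    ∃ r ∈ σ, r.time = lastRelease σ := by
  obtain ⟨r, hr, he⟩ := Finset.exists_mem_eq_sup σ h Request.time
  exact ⟨r, hr, he.symm⟩

theorem earlier_ssubset {σ : Finset Request} (h : σ.Nonempty) : earlier σ ⊂ σ := by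
  obtain ⟨r, hr, he⟩ := exists_time_eq_lastRelease h
  exact Finset.filter_ssubset.2 ⟨r, hr, he.not_lt⟩

open Classical in
/-- The route of the algorithm: whenever requests are released, the current route is replaced by a
good continuation. -/
noncomputable def goodRoute (σ : Finset Request) : ℝ≥0 → ℝ :=
  if _hσ : σ.Nonempty then
    -- The default route is never used when |loc| ≤ time for all requests, by `goodRoute_spec`.
    if h : ∃ q', (∀ t ≤ lastRelease σ, q' t = goodRoute (earlier σ) t) ∧ Good σ (lastRelease σ) q'
    then h.choose else fun _ => 0
  else fun _ => 0
termination_by σ.card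
decreasing_by all_goals exact Finset.card_lt_card (earlier_ssubset _hσ)

theorem goodRoute_spec (σ : Finset Request) (hσ : ∀ r ∈ σ, |r.loc| ≤ r.time) :
    Good σ (lastRelease σ) (goodRoute σ) ∧ (σ.Nonempty →
      ∀ t ≤ lastRelease σ, goodRoute σ t = goodRoute (earlier σ) t) := by
  induction hn : σ.card using Nat.strong_induction_on generalizing σ with
  | _ n ih =>
    rcases σ.eq_empty_or_nonempty with rfl | hne
    · rw [goodRoute]
      simpa [lastRelease] using good_empty
    · have hsub := earlier_ssubset hne
      have he := (ih _ (hn ▸ Finset.card_lt_card hsub) (earlier σ)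
        (fun r hr => hσ r (hsub.1 hr)) rfl).1
      have hex : ∃ q', (∀ t ≤ lastRelease σ, q' t = goodRoute (earlier σ) t) ∧
          Good σ (lastRelease σ) q' := by
        refine he.exists_union (fun s hs => ⟨hσ s (hsub.1 hs), time_le_lastRelease hs⟩)
          (Finset.sup_mono hsub.1) hσ hsub.1 hsub.ne fun s hs hs' => ?_
        by_contra hlt
        exact hs' (Finset.mem_filter.2 ⟨hs, (time_le_lastRelease hs).lt_of_ne hlt⟩)
      have heq : goodRoute σ = hex.choose := by
        rw [goodRoute, dif_pos hne, dif_pos hex]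
      rw [heq]
      exact ⟨hex.choose_spec.2, fun _ => hex.choose_spec.1⟩

/-- This is causality: removing the last batch leaves the route unchanged up to its release, and
this is repeated until only revealed requests remain. -/
theorem goodRoute_revealed (σ : Finset Request) (hσ : ∀ r ∈ σ, |r.loc| ≤ r.time) (t : ℝ≥0) :
    goodRoute σ t = goodRoute (revealed σ t) t := by
  induction hn : σ.card using Nat.strong_induction_on generalizing σ with
  | _ n ih =>
    rcases le_or_gt (lastRelease σ) t with h | h
    · have : revealed σ t = σ :=
        Finset.filter_eq_self.2 fun r hr => (time_le_lastRelease hr).trans h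
      rw [this]
    · have hne : σ.Nonempty := by
        rw [Finset.nonempty_iff_ne_empty]
        rintro rfl
        simp [lastRelease] at h
      have hsub := earlier_ssubset hne
      have hr : revealed (earlier σ) t = revealed σ t := by
        ext r
        simp only [revealed, earlier, Finset.mem_filter]
        exact ⟨fun hr => ⟨hr.1.1, hr.2⟩, fun hr => ⟨⟨hr.1, hr.2.trans_lt h⟩, hr.2⟩⟩
      rw [(goodRoute_spec σ hσ).2 hne t h.le, ih _ (hn ▸ Finset.card_lt_card hsub) (earlier σ)
        (fun r hr => hσ r (hsub.1 hr)) rfl, hr]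

/-- The request `r`, postponed to the first time at which it can be reached from the origin. -/
noncomputable def Request.postpone (r : Request) : Request := ⟨max r.time ‖r.loc‖₊, r.loc⟩

open Classical in
/-- The input with all requests postponed. -/
noncomputable def postpone (σ : Finset Request) : Finset Request := σ.image Request.postpone

theorem abs_loc_le_of_mem_postpone {σ : Finset Request} {r : Request} (hr : r ∈ postpone σ) :
    |r.loc| ≤ r.time := by
  classical
  obtain ⟨s, -, rfl⟩ := Finset.mem_image.1 hr
  simp only [Request.postpone, NNReal.coe_max, coe_nnnorm, Real.norm_eq_abs]
  exact le_max_right _ _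

/-- Postponing only delays, so it can be carried out online. -/
theorem revealed_postpone (σ : Finset Request) (t : ℝ≥0) :
    revealed (postpone σ) t = revealed (postpone (revealed σ t)) t := by
  classical
  ext r
  simp only [revealed, postpone, Finset.mem_filter, Finset.mem_image]
  constructor
  · rintro ⟨⟨s, hs, rfl⟩, ht⟩
    exact ⟨⟨s, ⟨hs, (le_max_left _ _).trans ht⟩, rfl⟩, ht⟩
  · rintro ⟨⟨s, hs, rfl⟩, ht⟩
    exact ⟨⟨s, hs.1, rfl⟩, ht⟩

theorem FeasibleBy.postpone {σ : Finset Request} {M : ℝ} (h : FeasibleBy σ M) :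
    FeasibleBy (postpone σ) M := by
  classical
  obtain ⟨h0, p, hp, h⟩ := h
  refine ⟨h0, p, hp, fun r hr => ?_⟩
  obtain ⟨s, hs, rfl⟩ := Finset.mem_image.1 hr
  obtain ⟨u, hu, huM⟩ := h s hs
  refine ⟨u, ⟨max_le hu.1 ?_, hu.2⟩, huM⟩
  have := hp.abs_sub_le u 0
  rw [hu.2, hp.start, sub_zero, NNReal.coe_zero, sub_zero, abs_of_nonneg u.coe_nonneg] at this
  rwa [← NNReal.coe_le_coe, coe_nnnorm, Real.norm_eq_abs]

/-- An online algorithm which follows good routes. -/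
noncomputable def goodAlgorithm : OnlineAlgorithm where
  pos σ := goodRoute (postpone σ)
  isRoute σ := (goodRoute_spec _ fun _ => abs_loc_le_of_mem_postpone).1.1
  causal σ σ' t h := by
    rw [goodRoute_revealed _ (fun _ => abs_loc_le_of_mem_postpone), revealed_postpone, h,
      ← revealed_postpone, ← goodRoute_revealed _ (fun _ => abs_loc_le_of_mem_postpone)]

theorem goodAlgorithm_isCompetitive : goodAlgorithm.IsCompetitive 2.04 := by
  classical
  intro σ _
  obtain ⟨T, hT, hM⟩ := (goodRoute_spec _ fun r hr => abs_loc_le_of_mem_postpone hr).1.served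
    (σ := postpone σ) fun r hr => time_le_lastRelease hr
  have h1 : goodAlgorithm.cost σ ≤ ENNReal.ofReal T := by
    refine makespan_le_ofReal fun r hr => ?_
    obtain ⟨u, hu, huT⟩ := hT r.postpone (Finset.mem_image_of_mem _ hr)
    exact ⟨u, ⟨(le_max_left _ _).trans hu.1, hu.2⟩, huT⟩
  exact h1.trans (ofReal_le_mul_OPT (by norm_num) fun M h => hM M h.postpone)

/-! ### The lower bound on the optimal cost -/

theorem isPoint_of_mem_points {σ : Finset Request} {x : ℝ} (h : x ∈ points σ) : IsPoint σ x := by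
  simpa [points, IsPoint] using h

theorem FeasibleBy.lastRelease_le {σ : Finset Request} {M : ℝ} (h : FeasibleBy σ M) :
    (lastRelease σ : ℝ) ≤ M := by
  rcases σ.eq_empty_or_nonempty with rfl | hne
  · simpa [lastRelease] using h.1
  · obtain ⟨r, hr, he⟩ := exists_time_eq_lastRelease hne
    rw [← he]
    exact h.time_le hr

theorem FeasibleBy.span_add_min_le {σ : Finset Request} {M : ℝ} (h : FeasibleBy σ M) {x y : ℝ}
    (hx : IsPoint σ x) (hy : IsPoint σ y) (hx0 : x ≤ 0) (hy0 : 0 ≤ y) :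
    y - x + min (-x) y ≤ M := by
  obtain ⟨u, hu, huu⟩ := h.exists_times
  rcases hx with rfl | ⟨r, hr, rfl⟩
  · rw [neg_zero, min_eq_left hy0]
    rcases hy with rfl | ⟨s, hs, rfl⟩
    · linarith [h.1]
    · linarith [le_abs_self s.loc, hu s hs]
  · have hr' := neg_abs_le r.loc
    rcases hy with rfl | ⟨s, hs, rfl⟩
    · rw [min_eq_right (by linarith)]
      linarith [hu r hr]
    · have h1 := hu r hr
      have h2 := hu s hs
      have h3 := le_abs_self s.loc
      have h4 := min_le_left (-r.loc) s.loc
      have h5 := min_le_right (-r.loc) s.loc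
      rcases le_abs.1 ((le_abs_self _).trans (huu s hs r hr)) with h6 | h6 <;> linarith

theorem leftLength_eq (σ : Finset Request) :
    leftLength σ = -(points σ).min' (points_nonempty σ) := by
  have : (points σ).min' (points_nonempty σ) ≤ 0 :=
    Finset.min'_le _ _ (Finset.mem_insert_self _ _)
  rw [leftLength, zero_sub, abs_of_nonneg (by linarith)]

theorem rightLength_eq (σ : Finset Request) :
    rightLength σ = (points σ).max' (points_nonempty σ) := by
  have : 0 ≤ (points σ).max' (points_nonempty σ) :=
    Finset.le_max' _ _ (Finset.mem_insert_self _ _)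
  rw [rightLength, zero_sub, abs_neg, abs_of_nonneg this]

theorem FeasibleBy.length_le {σ : Finset Request} {M D β : ℝ} (h : FeasibleBy σ M) (hD : 0 < D)
    (hlr : leftLength σ + rightLength σ = D)
    (hβ : min (leftLength σ) (rightLength σ) / D = β) : (1 + β) * D ≤ M := by
  have h1 := h.span_add_min_le (isPoint_of_mem_points (Finset.min'_mem _ (points_nonempty σ)))
    (isPoint_of_mem_points (Finset.max'_mem _ (points_nonempty σ)))
    (Finset.min'_le _ _ (Finset.mem_insert_self _ _))
    (Finset.le_max' _ _ (Finset.mem_insert_self _ _))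
  rw [← leftLength_eq, ← rightLength_eq] at h1
  rw [div_eq_iff hD.ne'] at hβ
  have := leftLength_eq σ
  have := rightLength_eq σ
  linarith

/-! ### The sweep -/

theorem moveToward_of_le {x a s : ℝ} (hs : 0 ≤ s) (h : a ≤ x) :
    moveToward x a s = max (x - s) a := by
  rw [moveToward, min_eq_right (by linarith), ← max_add_add_left]
  congr 1
  ring

theorem moveToward_of_ge {x a s : ℝ} (hs : 0 ≤ s) (h : x ≤ a) :
    moveToward x a s = min (x + s) a := by
  have h1 : -s ≤ min s (a - x) := le_min (by linarith) (by linarith)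
  rw [moveToward, max_eq_right h1, ← min_add_add_left, add_sub_cancel]

theorem replan_of_le {σ : Finset Request} {p : ℝ≥0 → ℝ} {τ t : ℝ≥0} (h : t ≤ τ) :
    replan σ p τ t = p t := if_pos h

theorem replan_of_ge {σ : Finset Request} {p : ℝ≥0 → ℝ} {τ t : ℝ≥0} (h : τ ≤ t) :
    replan σ p τ t = walk (p τ) (tour (p τ) (outstanding σ p τ)).1
      (tour (p τ) (outstanding σ p τ)).2 ((t : ℝ) - τ) := by
  rcases h.eq_or_lt with rfl | h
  · rw [replan_of_le le_rfl, sub_self, walk_zero]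
  · exact if_neg (not_le.2 h)

/-- The server passes r at time τ + (r.loc - a), so no unserved request of this kind is ever behind
it. -/
theorem served_of_move_right {q : ℝ≥0 → ℝ} {τ : ℝ} {a b : ℝ} (hτ : 0 ≤ τ)
    (hq : ∀ t : ℝ≥0, τ ≤ t → q t = min (a + (t - τ)) b) {r : Request} (hr : r.time ≤ τ)
    (ha : a ≤ r.loc) (hb : r.loc ≤ b) :
    (∃ u : ℝ≥0, ServedAt q r u ∧ (u : ℝ) ≤ τ + (b - a)) ∧
      ∀ t : ℝ≥0, τ ≤ t → (∀ u ≤ t, ¬ ServedAt q r u) → q t ≤ r.loc := by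
  obtain ⟨u, hu⟩ : ∃ u : ℝ≥0, (u : ℝ) = τ + (r.loc - a) := ⟨⟨_, by linarith⟩, rfl⟩
  have hs : ServedAt q r u := by
    refine ⟨NNReal.coe_le_coe.1 (by linarith), ?_⟩
    rw [hq u (by linarith), hu, min_eq_left (by linarith)]
    ring
  refine ⟨⟨u, hs, by linarith⟩, fun t ht hun => ?_⟩
  by_contra! hlt
  refine hun u (NNReal.coe_le_coe.1 ?_) hs
  rw [hq t ht] at hlt
  linarith [min_le_left (a + ((t : ℝ) - τ)) b]

theorem served_of_move_left {q : ℝ≥0 → ℝ} {τ : ℝ} {a b : ℝ} (hτ : 0 ≤ τ)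
    (hq : ∀ t : ℝ≥0, τ ≤ t → q t = max (b - (t - τ)) a) {r : Request} (hr : r.time ≤ τ)
    (ha : a ≤ r.loc) (hb : r.loc ≤ b) :
    (∃ u : ℝ≥0, ServedAt q r u ∧ (u : ℝ) ≤ τ + (b - a)) ∧
      ∀ t : ℝ≥0, τ ≤ t → (∀ u ≤ t, ¬ ServedAt q r u) → r.loc ≤ q t := by
  obtain ⟨u, hu⟩ : ∃ u : ℝ≥0, (u : ℝ) = τ + (b - r.loc) := ⟨⟨_, by linarith⟩, rfl⟩
  have hs : ServedAt q r u := by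
    refine ⟨NNReal.coe_le_coe.1 (by linarith), ?_⟩
    rw [hq u (by linarith), hu, max_eq_left (by linarith)]
    ring
  refine ⟨⟨u, hs, by linarith⟩, fun t ht hun => ?_⟩
  by_contra! hlt
  refine hun u (NNReal.coe_le_coe.1 ?_) hs
  rw [hq t ht] at hlt
  linarith [le_max_left (b - ((t : ℝ) - τ)) a]

/-- The requests of `S` which are not served on `p` up to time `t`. -/
def Unserved (S : Finset Request) (p : ℝ≥0 → ℝ) (t : ℝ≥0) (r : Request) : Prop :=
  r ∈ S ∧ ∀ u ≤ t, ¬ ServedAt p r u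

/-- The invariant of the sweep: on one of the two sides of the server, all outstanding requests are
within distance `Δ`. -/
structure SweepInvariant (m M Δ : ℝ) (S : Finset Request) (τ : ℝ≥0) (p : ℝ≥0 → ℝ) : Prop where
  hull : ∀ t, τ ≤ t → m ≤ p t ∧ p t ≤ M
  near : ∀ t, τ ≤ t → (∀ r, Unserved S p t r → p t - r.loc ≤ Δ) ∨
    ∀ r, Unserved S p t r → r.loc - p t ≤ Δ
  served : ∀ r ∈ S, ∃ u : ℝ≥0, ServedAt p r u ∧ (u : ℝ) ≤ τ + Δ + (M - m)

/-- The invariant holds on a tour which serves all outstanding requests. -/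
theorem SweepInvariant.of_tour {m M Δ l r : ℝ} (hΔ : 0 ≤ Δ) {S : Finset Request} {τ : ℝ≥0}
    {p : ℝ≥0 → ℝ} (hS : ∀ s ∈ S, s.time ≤ τ)
    (hlr : ∀ s, Unserved S p τ s → l ≤ s.loc ∧ s.loc ≤ r)
    (hml : m ≤ l) (hrM : r ≤ M) (hm : m ≤ p τ) (hM : p τ ≤ M)
    (hl : l ≤ r) (hnear : p τ - l ≤ Δ ∨ r - p τ ≤ Δ)
    (hwalk : ∀ t, τ ≤ t →
      p t = walk (p τ) (chooseTour (p τ) l r).1 (chooseTour (p τ) l r).2 ((t : ℝ) - τ)) :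
    SweepInvariant m M Δ S τ p := by
  have hun : ∀ t, τ ≤ t → ∀ s, Unserved S p t s → Unserved S p τ s := fun t ht s hs =>
    ⟨hs.1, fun u hu => hs.2 u (hu.trans ht)⟩
  have hserved : (∀ s, Unserved S p τ s →
      ∃ u : ℝ≥0, ServedAt p s u ∧ (u : ℝ) ≤ τ + Δ + (M - m)) →
      ∀ s ∈ S, ∃ u : ℝ≥0, ServedAt p s u ∧ (u : ℝ) ≤ τ + Δ + (M - m) := by
    intro h s hs
    by_cases hu : Unserved S p τ s
    · exact h s hu
    · simp only [Unserved, hs, true_and, not_forall, not_not] at hu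
      obtain ⟨u, hut, hsu⟩ := hu
      have : (u : ℝ) ≤ τ := hut
      exact ⟨u, hsu, by linarith⟩
  have hS' : ∀ s, Unserved S p τ s → (s.time : ℝ) ≤ τ := fun s hs => hS s hs.1
  have hτ : (0 : ℝ) ≤ τ := τ.2
  unfold chooseTour at hwalk
  split_ifs at hwalk with h1 h2 h3
  · have hq : ∀ t : ℝ≥0, (τ : ℝ) ≤ t → p t = max (p τ - (t - τ)) l := by
      intro t ht
      rw [hwalk t ht, walk, abs_sub_comm, abs_of_nonneg (by linarith)]
      split_ifs with h
      · exact moveToward_of_le (by linarith) (by linarith)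
      · rw [moveToward_of_le (by linarith) le_rfl, max_eq_right (by linarith),
          max_eq_right (by linarith)]
    have key := fun s hs => served_of_move_left hτ hq (hS' s hs) (hlr s hs).1
      ((hlr s hs).2.trans h1)
    refine ⟨fun t ht => ?_, fun t ht => Or.inr fun s hs => ?_, hserved fun s hs => ?_⟩
    · have : (τ : ℝ) ≤ t := ht
      rw [hq t ht]
      exact ⟨hml.trans (le_max_right _ _), max_le (by linarith) (by linarith)⟩
    · linarith [(key s (hun t ht s hs)).2 t ht hs.2]
    · obtain ⟨u, hu, huT⟩ := (key s hs).1
      exact ⟨u, hu, by linarith⟩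
  · have hq : ∀ t : ℝ≥0, (τ : ℝ) ≤ t → p t = min (p τ + (t - τ)) r := by
      intro t ht
      rw [hwalk t ht, walk, abs_of_nonneg (by linarith)]
      split_ifs with h
      · exact moveToward_of_ge (by linarith) (by linarith)
      · rw [moveToward_of_ge (by linarith) le_rfl, min_eq_right (by linarith),
          min_eq_right (by linarith)]
    have key := fun s hs => served_of_move_right hτ hq (hS' s hs) (h2.trans (hlr s hs).1)
      (hlr s hs).2
    refine ⟨fun t ht => ?_, fun t ht => Or.inl fun s hs => ?_, hserved fun s hs => ?_⟩
    · have : (τ : ℝ) ≤ t := ht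
      rw [hq t ht]
      exact ⟨le_min (by linarith) (by linarith), (min_le_right _ _).trans hrM⟩
    · linarith [(key s (hun t ht s hs)).2 t ht hs.2]
    · obtain ⟨u, hu, huT⟩ := (key s hs).1
      exact ⟨u, hu, by linarith⟩
  · push Not at h1 h2
    -- Whichever end `hnear` bounds, the nearer end, visited first, is within Δ.
    have hd : p τ - l ≤ Δ := by rcases hnear with h | h <;> linarith
    have hq1 : ∀ t : ℝ≥0, (τ : ℝ) ≤ t → (t : ℝ) ≤ τ + (p τ - l) →
        p t = p τ - (t - τ) := by
      intro t ht h
      rw [hwalk t ht, walk, abs_sub_comm, abs_of_nonneg (by linarith), if_pos (by linarith),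
        moveToward_of_le (by linarith) h2.le, max_eq_left (by linarith)]
    have hq2 : ∀ t : ℝ≥0, τ + (p τ - l) ≤ (t : ℝ) →
        p t = min (l + (t - (τ + (p τ - l)))) r := by
      intro t h
      have ht : (τ : ℝ) ≤ t := by linarith
      rcases h.eq_or_lt with h' | h'
      · rw [hq1 t ht h'.ge, ← h', min_eq_left (by linarith)]
        ring
      · rw [hwalk t ht, walk, abs_sub_comm, abs_of_nonneg (by linarith), if_neg (by linarith),
          moveToward_of_ge (by linarith) hl]
        congr 1
        ring
    have key := fun s hs => served_of_move_right (by linarith) hq2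
      ((hS' s hs).trans (by linarith)) (hlr s hs).1 (hlr s hs).2
    refine ⟨fun t ht => ?_, fun t ht => Or.inl fun s hs => ?_, hserved fun s hs => ?_⟩
    · have ht' : (τ : ℝ) ≤ t := ht
      rcases le_total (t : ℝ) (τ + (p τ - l)) with h | h
      · rw [hq1 t ht h]
        constructor <;> linarith
      · rw [hq2 t h]
        exact ⟨le_min (by linarith) (by linarith), (min_le_right _ _).trans hrM⟩
    · have ht' : (τ : ℝ) ≤ t := ht
      have hs' := hun t ht s hs
      rcases le_total (t : ℝ) (τ + (p τ - l)) with h | h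
      · rw [hq1 t ht h]
        linarith [(hlr s hs').1]
      · linarith [(key s hs').2 t h hs.2]
    · obtain ⟨u, hu, huT⟩ := (key s hs).1
      exact ⟨u, hu, by linarith⟩
  · push Not at h1 h2 h3
    have hd : r - p τ ≤ Δ := by rcases hnear with h | h <;> linarith
    have hq1 : ∀ t : ℝ≥0, (τ : ℝ) ≤ t → (t : ℝ) ≤ τ + (r - p τ) →
        p t = p τ + (t - τ) := by
      intro t ht h
      rw [hwalk t ht, walk, abs_of_nonneg (by linarith), if_pos (by linarith),
        moveToward_of_ge (by linarith) h1.le, min_eq_left (by linarith)]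
    have hq2 : ∀ t : ℝ≥0, τ + (r - p τ) ≤ (t : ℝ) →
        p t = max (r - (t - (τ + (r - p τ)))) l := by
      intro t h
      have ht : (τ : ℝ) ≤ t := by linarith
      rcases h.eq_or_lt with h' | h'
      · rw [hq1 t ht h'.ge, ← h', max_eq_left (by linarith)]
        ring
      · rw [hwalk t ht, walk, abs_of_nonneg (by linarith), if_neg (by linarith),
          moveToward_of_le (by linarith) hl]
        congr 1
        ring
    have key := fun s hs => served_of_move_left (by linarith) hq2
      ((hS' s hs).trans (by linarith)) (hlr s hs).1 (hlr s hs).2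
    refine ⟨fun t ht => ?_, fun t ht => Or.inr fun s hs => ?_, hserved fun s hs => ?_⟩
    · have ht' : (τ : ℝ) ≤ t := ht
      rcases le_total (t : ℝ) (τ + (r - p τ)) with h | h
      · rw [hq1 t ht h]
        constructor <;> linarith
      · rw [hq2 t h]
        exact ⟨hml.trans (le_max_right _ _), max_le (by linarith) (by linarith)⟩
    · have ht' : (τ : ℝ) ≤ t := ht
      have hs' := hun t ht s hs
      rcases le_total (t : ℝ) (τ + (r - p τ)) with h | h
      · rw [hq1 t ht h]
        linarith [(hlr s hs').2]
      · linarith [(key s hs').2 t h hs.2]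
    · obtain ⟨u, hu, huT⟩ := (key s hs).1
      exact ⟨u, hu, by linarith⟩

theorem mem_outstanding {σ : Finset Request} {p : ℝ≥0 → ℝ} {τ : ℝ≥0} {x : ℝ} :
    x ∈ outstanding σ p τ ↔ ∃ r, Unserved (revealed σ τ) p τ r ∧ r.loc = x := by
  classical
  simp only [outstanding, Finset.mem_image, Finset.mem_filter, Unserved, not_exists, not_and]

/-- New requests are within Δ on both sides, so they cannot spoil the side that was near before. -/
theorem SweepInvariant.replan {m M Δ : ℝ} (hΔ : 0 ≤ Δ) {σ S : Finset Request} {τ τ' : ℝ≥0}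
    {p : ℝ≥0 → ℝ} (h : SweepInvariant m M Δ S τ p) (hσ : ∀ r ∈ σ, m ≤ r.loc ∧ r.loc ≤ M)
    (hτ : τ ≤ τ') (hnew : ∀ r ∈ revealed σ τ', r ∈ S ∨ |p τ' - r.loc| ≤ Δ) :
    SweepInvariant m M Δ (revealed σ τ') τ' (replan σ p τ') := by
  have hp : LineTSP.replan σ p τ' τ' = p τ' := replan_of_le le_rfl
  have hun : ∀ s, Unserved (revealed σ τ') (LineTSP.replan σ p τ') τ' s →
      Unserved (revealed σ τ') p τ' s := fun s hs =>
    ⟨hs.1, fun u hu hsu => hs.2 u hu ⟨hsu.1, by rw [replan_of_le hu]; exact hsu.2⟩⟩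
  have hrt : ∀ s ∈ revealed σ τ', s.time ≤ τ' := fun s hs => (Finset.mem_filter.1 hs).2
  have hh := h.hull τ' hτ
  by_cases ho : (outstanding σ p τ').Nonempty
  · obtain ⟨a, ha, ha'⟩ := mem_outstanding.1 (Finset.min'_mem _ ho)
    obtain ⟨b, hb, hb'⟩ := mem_outstanding.1 (Finset.max'_mem _ ho)
    have hnear : (∀ r, Unserved (revealed σ τ') p τ' r → p τ' - r.loc ≤ Δ) ∨
        ∀ r, Unserved (revealed σ τ') p τ' r → r.loc - p τ' ≤ Δ := by
      refine (h.near τ' hτ).imp (fun h r hr => ?_) fun h r hr => ?_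
      · rcases hnew r hr.1 with h1 | h1
        · exact h r ⟨h1, hr.2⟩
        · exact (abs_le.1 h1).2
      · rcases hnew r hr.1 with h1 | h1
        · exact h r ⟨h1, hr.2⟩
        · linarith [(abs_le.1 h1).1]
    refine SweepInvariant.of_tour (l := (outstanding σ p τ').min' ho)
      (r := (outstanding σ p τ').max' ho) hΔ hrt (fun s hs => ?_) ?_ ?_ (hp ▸ hh.1) (hp ▸ hh.2)
      (Finset.min'_le_max' _ ho) ?_ fun t ht => ?_
    · have := mem_outstanding.2 ⟨s, hun s hs, rfl⟩
      exact ⟨Finset.min'_le _ _ this, Finset.le_max' _ _ this⟩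
    · rw [← ha']
      exact (hσ a (Finset.mem_filter.1 ha.1).1).1
    · rw [← hb']
      exact (hσ b (Finset.mem_filter.1 hb.1).1).2
    · rw [hp, ← ha', ← hb']
      exact hnear.imp (fun h => h a ha) fun h => h b hb
    · rw [replan_of_ge ht, hp, tour, dif_pos ho]
  · have hnone : ∀ s, ¬ Unserved (revealed σ τ') p τ' s := fun s hs =>
      ho ⟨_, mem_outstanding.2 ⟨s, hs, rfl⟩⟩
    refine SweepInvariant.of_tour (l := p τ') (r := p τ') hΔ hrt
      (fun s hs => absurd (hun s hs) (hnone s)) hh.1 hh.2 (hp ▸ hh.1) (hp ▸ hh.2) le_rfl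
      (Or.inl (by rw [hp, sub_self]; exact hΔ)) fun t ht => ?_
    rw [replan_of_ge ht, hp, tour, dif_neg ho, chooseTour, if_pos le_rfl]

/-- S collects the requests already processed. Locality refers to the final route, but later
recomputations keep positions up to the current release time, so it applies at the moment of
replanning. -/
theorem SweepInvariant.foldl {m M Δ : ℝ} (hΔ : 0 ≤ Δ) {σ : Finset Request}
    (hσ : ∀ r ∈ σ, m ≤ r.loc ∧ r.loc ≤ M) (L : List ℝ≥0) (hL : L.Pairwise (· < ·))
    (hlast : ∀ t ∈ L, t ≤ lastRelease σ) {S : Finset Request} {τ : ℝ≥0} {p : ℝ≥0 → ℝ}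
    (h : SweepInvariant m M Δ S τ p) (hS : ∀ r ∈ S, r.time ≤ τ) (hτ : ∀ t ∈ L, τ ≤ t)
    (hτl : τ ≤ lastRelease σ) (hcover : ∀ r ∈ σ, r ∈ S ∨ r.time ∈ L)
    (hloc : ∀ r ∈ σ, r ∉ S → |L.foldl (LineTSP.replan σ) p r.time - r.loc| ≤ Δ) :
    ∀ r ∈ σ, ∃ u : ℝ≥0, ServedAt (L.foldl (LineTSP.replan σ) p) r u ∧
      (u : ℝ) ≤ lastRelease σ + Δ + (M - m) := by
  induction L generalizing S τ p with
  | nil =>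
    intro r hr
    obtain ⟨u, hu, hu'⟩ := h.served r ((hcover r hr).resolve_right List.not_mem_nil)
    have : (τ : ℝ) ≤ lastRelease σ := hτl
    exact ⟨u, hu, by linarith⟩
  | cons τ' L ih =>
    rw [List.pairwise_cons] at hL
    have hτ' := hτ τ' List.mem_cons_self
    have hge : ∀ u ∈ τ' :: L, τ' ≤ u := by
      intro u hu
      rcases List.mem_cons.1 hu with rfl | hu
      · exact le_rfl
      · exact (hL.1 u hu).le
    have hstep := h.replan hΔ hσ hτ' fun r hr => by
      rw [or_iff_not_imp_left]
      intro hrS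
      rw [revealed, Finset.mem_filter] at hr
      have ht : r.time = τ' := le_antisymm hr.2 (hge _ ((hcover r hr.1).resolve_left hrS))
      have := hloc r hr.1 hrS
      rwa [ht, foldl_replan_of_le σ τ' (τ' :: L) p hge] at this
    have hmem : ∀ r ∈ σ, r ∈ S → r ∈ revealed σ τ' := fun r hr hrS =>
      Finset.mem_filter.2 ⟨hr, (hS r hrS).trans hτ'⟩
    refine ih hL.2 (fun t ht => hlast t (List.mem_cons_of_mem _ ht)) hstep
      (fun r hr => (Finset.mem_filter.1 hr).2) (fun t ht => (hL.1 t ht).le)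
      (hlast τ' List.mem_cons_self) (fun r hr => ?_) fun r hr hrS =>
        hloc r hr fun h => hrS (hmem r hr h)
    rcases hcover r hr with h1 | h1
    · exact Or.inl (hmem r hr h1)
    · rcases List.mem_cons.1 h1 with h2 | h2
      · exact Or.inl (Finset.mem_filter.2 ⟨hr, h2.le⟩)
      · exact Or.inr h2

theorem sweep_cost_le {σ : Finset Request} {Δ : ℝ} (hΔ : 0 ≤ Δ) (h : SpatiallyLocal sweep Δ σ) :
    sweep.cost σ ≤
      ENNReal.ofReal (lastRelease σ + Δ + (leftLength σ + rightLength σ)) := by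
  refine makespan_le_ofReal ?_
  rw [leftLength_eq, rightLength_eq, neg_add_eq_sub]
  have hmem : ∀ r ∈ σ, r.loc ∈ points σ := fun r hr =>
    Finset.mem_insert_of_mem (Finset.mem_image_of_mem _ hr)
  have h0 : (0 : ℝ) ∈ points σ := Finset.mem_insert_self _ _
  have hinit : SweepInvariant ((points σ).min' (points_nonempty σ))
      ((points σ).max' (points_nonempty σ)) Δ ∅ 0 fun _ => 0 :=
    ⟨fun _ _ => ⟨Finset.min'_le _ _ h0, Finset.le_max' _ _ h0⟩,
      fun _ _ => Or.inl fun r hr => absurd hr.1 (Finset.notMem_empty r), by simp⟩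
  have htimes : ∀ t, t ∈ releaseTimes σ ↔ ∃ r ∈ σ, r.time = t := by
    simp [releaseTimes]
  refine hinit.foldl hΔ
    (fun r hr => ⟨Finset.min'_le _ _ (hmem r hr), Finset.le_max' _ _ (hmem r hr)⟩)
    (releaseTimes σ) (Finset.sortedLT_sort _).pairwise (fun t ht => ?_) (by simp)
    (fun _ _ => zero_le) zero_le (fun r hr => Or.inr ((htimes _).2 ⟨r, hr, rfl⟩)) fun r hr _ => h r hr
  obtain ⟨r, hr, rfl⟩ := (htimes t).1 ht
  exact time_le_lastRelease hr

end LineTSP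

open LineTSP in
theorem mainTheorem2 :
    (∃ B : OnlineAlgorithm, B.IsCompetitive 2.04) ∧
    ∀ B : OnlineAlgorithm, B.IsCompetitive 2.04 →
      ∀ D δ β : ℝ, 0 < D → 0 ≤ δ → δ ≤ 1 → 0 ≤ β → β ≤ 1 / 2 →
        (lineAlgorithm B δ β).IsCompetitiveOn (lineInputs (lineAlgorithm B δ β) D β (δ * D))
          (min 2.04 (1 + (1 + δ) / (1 + β))) ∧
        ∀ σ ∈ lineInputs (lineAlgorithm B δ β) D β (δ * D),
          ENNReal.ofReal (max (lastRelease σ : ℝ) ((1 + β) * D)) ≤ OPT σ ∧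
          (1 + (1 + δ) / (1 + β) < 2.04 →
            (lineAlgorithm B δ β).cost σ ≤ ENNReal.ofReal (lastRelease σ + δ * D + D)) := by
  refine ⟨⟨goodAlgorithm, goodAlgorithm_isCompetitive⟩, fun B hB D δ β hD hδ _ hβ _ => ?_⟩
  have hcost : ∀ σ ∈ lineInputs (lineAlgorithm B δ β) D β (δ * D), 1 + (1 + δ) / (1 + β) < 2.04 →
      (lineAlgorithm B δ β).cost σ ≤ ENNReal.ofReal (lastRelease σ + δ * D + D) := by
    rintro σ ⟨h1, -, h3⟩ hlt
    rw [lineAlgorithm, if_neg (not_le.2 hlt)] at h3 ⊢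
    have := sweep_cost_le (mul_nonneg hδ hD.le) h3
    rwa [h1] at this
  refine ⟨fun σ hσ => ?_, fun σ hσ => ⟨?_, hcost σ hσ⟩⟩
  · rcases le_or_gt 2.04 (1 + (1 + δ) / (1 + β)) with h | h
    · rw [min_eq_left h, lineAlgorithm, if_pos h]
      exact hB σ (Set.mem_univ σ)
    · rw [min_eq_right h.le]
      have hpos : 0 < (1 + δ) / (1 + β) := by positivity
      refine (hcost σ hσ h).trans (ofReal_le_mul_OPT (by linarith) fun M hM => ?_)
      have h1 := hM.lastRelease_le
      -- Since (1 + δ)D is (1 + δ)/(1 + β) times (1 + β)D, it is at most that multiple of M; t_max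
      -- accounts for the remaining M.
      have h2 := mul_le_mul_of_nonneg_left (hM.length_le hD hσ.1 hσ.2.1) hpos.le
      rw [← mul_assoc, div_mul_cancel₀ _ (by linarith)] at h2
      linarith
  · have := ofReal_le_mul_OPT (σ := σ) (x := max (lastRelease σ : ℝ) ((1 + β) * D)) one_pos
      fun M hM => by
        rw [one_mul]
        exact max_le hM.lastRelease_le (hM.length_le hD hσ.1 hσ.2.1)
    rwa [ENNReal.ofReal_one, one_mul] at this
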